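/- **Dihedral data.** Let $m\ge 2$. In $\mathbb R^2$ let $H_j$ ($j\in\mathbb Z/m$) be the line at angle $j\pi/m$ to the first axis, $s_j$ the reflection in $H_j$, $f_j$ a linear form on $\mathbb C^2$ with kernel $H_j\otimes\mathbb C$, and $\omega_j=d\log f_j$. Given $\kappa\in\mathbb C$ and pairs $(k_0,\alpha_0),(k_1,\alpha_1)\in\mathbb C^\times\times\mathbb C$, equal if $m$ is odd, extend them to all $j\in\mathbb Z/m$ so that $(k_j,\alpha_j)$ depends only on the conjugacy class of $s_j$ in the dihedral group $D_m$. On $V=\bigoplus_{j\in\mathbb Z/m}\mathbb C v_j$ let $\iota(s_i)v_j=v_{2i-j}$ (so $s_i(H_j)=H_{2i-j}$), $p_iv_i=\alpha_iv_i$, and $p_iv_j=\big(\sum_{t:\,s_t(H_j)=H_i}k_t\big)v_i$ for $j\neq i$. Consider the flat $D_m$-invariant connection with flat sections $dF=\Omega F$, $\Omega=\kappa\sum_i(k_i\iota(s_i)-p_i)\,\omega_i$, on the complement of the complexified lines. Let $p$ be the point at angle $\pi/2m$ on the unit circle and let $\sigma_a$ ($a=0,1$) be the Artin generator represented by the positive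 half turn in $p+\mathbb C\,(s_a(p)-p)$ about the orthogonal projection of $p$ to $H_a$, from $p$ to $s_a(p)$. Let $T(\sigma_a)=\iota(s_a)^{-1}P_a$ be its monodromy, $P_a$ being parallel transport along this path. Put $q_a=\exp(\kappa\pi\sqrt{-1}\,k_a)$, $l_a=\exp(\kappa\pi\sqrt{-1}\,\alpha_a)/q_a$ and $e_a=\frac{l_a}{q_a^{-1}-q_a}(T(\sigma_a)-q_a)(T(\sigma_a)+q_a^{-1})$. For a word $X$ in the letters $X_0,X_1,E_0,E_1$ let $f(X)\in\mathrm{End}(V)$ be obtained by substituting $X_a\mapsto T(\sigma_a)$, $E_a\mapsto e_a$. Define $\Phi^a(X)\in\mathbb C$ to be the unique scalar with $e_af(X)e_a=\Phi^a(X)\,e_a$. (For generic parameters $e_a$ has rank one, so there is exactly one such scalar; for definiteness put $\Phi^a(X)=0$ if there is not exactly one.) **The algebra.** Let $\Gamma=(m_{i,j})_{1\le i,j\le n}$ be a Coxeter matrix with Coxeter group $W_\Gamma$ and simple reflections $s_1,\dots,s_n$. Let $\Pi$ consist of pairs $(k_i,\alpha_i)\in\mathbb C^\times\times\mathbb C$,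 $1\le i\le n$, with $(k_i,\alpha_i)=(k_j,\alpha_j)$ whenever $s_i$ and $s_j$ are conjugate, let $\kappa\in\mathbb C$, and put $q_i=\exp(\kappa\pi\sqrt{-1}\,k_i)$, $l_i=\exp(\kappa\pi\sqrt{-1}\,\alpha_i)/q_i$. Write $[xy\cdots]_m$ for the alternating product with $m$ factors beginning with $x$, and $\Lambda_{i,j}$ for the free monoid on $X_i,E_i,X_j,E_j$. For $i<j$ with $m_{i,j}<\infty$ let $\Phi^i_{i,j},\Phi^j_{i,j}:\Lambda_{i,j}\to\mathbb C$ be the functions $\Phi^0,\Phi^1$ above for $m=m_{i,j}$ and the parameters $(k_i,\alpha_i),(k_j,\alpha_j),\kappa$, with $i,j$ in the roles of $0,1$. The algebra $B_\Gamma(\Pi,\kappa)$ is the unital associative $\mathbb C$-algebra generated by $X_i,X_i^-,E_i$ ($1\le i\le n$) with relations 1. $X_iX_i^-=X_i^-X_i=1$ for all $i$; 2. $[X_iX_j\cdots]_{m_{i,j}}=[X_jX_i\cdots]_{m_{i,j}}$ for all $i\ne j$ with $m_{i,j}<\infty$; 3. $(q_i^{-1}-q_i)E_i=l_i(X_i-q_i)(X_i+q_i^{-1})$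 for all $i$; 4. $X_iE_i=E_iX_i=l_i^{-1}E_i$ for all $i$; 5. $E_iXE_i=\Phi^i_{i,j}(X)E_i$ and $E_jXE_j=\Phi^j_{i,j}(X)E_j$ for all $i<j$ with $m_{i,j}<\infty$ and all $X\in\Lambda_{i,j}$; 6. $E_iXE_j=0$ for all $i\ne j$ and $X\in\Lambda_{i,j}$ if $m_{i,j}$ is an even number greater than $2$. **Theorem 5.1.** Let $\Gamma$ be of finite type, i.e. $W_\Gamma$ is finite, and suppose $q_i\ne q_i^{-1}$ for all $i$. Then $B_\Gamma(\Pi,\kappa)$ is finite dimensional over $\mathbb C$. More precisely, $W_\Gamma$ has an element $w_0$ of maximal length, and $B_\Gamma(\Pi,\kappa)$ is spanned by the words in the letters $X_i,E_i$ ($1\le i\le n$) of length at most the length of $w_0$. -/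

import Mathlib

noncomputable section

namespace BMW

/-- The letters `X_i`, `E_i`. -/
inductive Letter (ι : Type) : Type
  | X (i : ι) : Letter ι
  | E (i : ι) : Letter ι

/-! ### The generalized Lawrence-Krammer representation of a dihedral Artin group

The reflection lines of the dihedral group `D_m` of order `2m` in the plane are `H_j`, `j ∈ ℤ/m`,
where `H_j` makes the angle `jπ/m` with the first axis; `s_j` is the reflection in `H_j`. -/

/-- The angle between `H_j` and the first axis. -/
def angle (m : ℕ) (j : ZMod m) : ℝ := j.val * Real.pi / m

/-- The linear form `f_j` on `ℂ²` with kernel the complexification of `H_j`; it is the bilinear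
pairing with the real unit normal vector of `H_j`. -/
def linForm (m : ℕ) (j : ZMod m) (x : ℂ × ℂ) : ℂ :=
  -(Real.sin (angle m j) : ℂ) * x.1 + (Real.cos (angle m j) : ℂ) * x.2

/-- The real unit normal vector of `H_j`. -/
def normal (m : ℕ) (j : ZMod m) : ℂ × ℂ :=
  (-(Real.sin (angle m j) : ℂ), (Real.cos (angle m j) : ℂ))

/-- The base point: it lies on the bisector of the chamber bounded by `H_0` and `H_1`. -/
def basePoint (m : ℕ) : ℂ × ℂ :=
  ((Real.cos (Real.pi / (2 * m)) : ℂ), (Real.sin (Real.pi / (2 * m)) : ℂ))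

/-- The path from the base point `p` to `s_j p` (`j = 0, 1`) whose image in the orbit space of the
complement of the arrangement represents the Artin generator `σ_j`. With `p_j` the orthogonal
projection of `p` to `H_j`, it is the positive half turn `p_j + exp(π√-1 t) (p - p_j)`. It meets no
complexified reflection line, and the half turn of any smaller radius about `p_j`, joined to
`p` and `s_j p` by real segments, is homotopic to it in the complement. -/
def halfTurn (m : ℕ) (j : ZMod m) (t : ℝ) : ℂ × ℂ :=
  basePoint m -
    ((1 - Complex.exp (Real.pi * Complex.I * t)) * linForm m j (basePoint m)) • normal m j

/-- The class function on the reflections of `D_m` with value `c 0` at the conjugates of `s_0` and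
`c 1` at those of `s_1`. (For `m` odd there is only one class, and `c 0 = c 1` in all uses.) -/
def classFun (m : ℕ) (c : Fin 2 → ℂ) (j : ZMod m) : ℂ := if Even j.val then c 0 else c 1

/-- The permutation operator `ι(s_j) : v_b ↦ v_{s_j(b)}`, where `s_j (H_b) = H_{2j-b}`. -/
def reflMatrix (m : ℕ) (j : ZMod m) : Matrix (ZMod m) (ZMod m) ℂ :=
  fun a b => if a = 2 * j - b then 1 else 0

/-- The operator `p_i`: `p_i v_i = α_i v_i`, and
`p_i v_b = (∑ k_t over the reflections s_t with s_t (H_b) = H_i) v_i` for `b ≠ i`. -/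
def projMatrix (m : ℕ) [NeZero m] (k α : Fin 2 → ℂ) (i : ZMod m) : Matrix (ZMod m) (ZMod m) ℂ :=
  fun a b =>
    if a = i then
      if b = i then classFun m α i
      else ∑ t : ZMod m, if 2 * t - b = i then classFun m k t else 0
    else 0

/-- The pull-back to `[0,1]`, along `halfTurn m j`, of the connection form
`Ω = κ ∑_i (k_i ι(s_i) - p_i) d log f_i`. -/
def connectionAlong (m : ℕ) [NeZero m] (k α : Fin 2 → ℂ) (κ : ℂ) (j : ZMod m) (t : ℝ) :
    Matrix (ZMod m) (ZMod m) ℂ :=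
  κ • ∑ i : ZMod m, logDeriv (fun s : ℝ => linForm m i (halfTurn m j s)) t •
    (classFun m k i • reflMatrix m i - projMatrix m k α i)

/-- `F` is the fundamental solution on `[0,1]` of the equation `F' = A F`, `F 0 = 1`. -/
def IsFundamentalSolution {ι : Type} [Fintype ι] [DecidableEq ι] (A F : ℝ → Matrix ι ι ℂ) : Prop :=
  F 0 = 1 ∧ ∀ t ∈ Set.Icc (0 : ℝ) 1, ∀ a b,
    HasDerivWithinAt (fun s => F s a b) ((A t * F t) a b) (Set.Icc 0 1) t

open Classical in
/-- Parallel transport from time `0` to time `1` for the flat sections `F' = A F`. (For a continuous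
`A` the fundamental solution on `[0,1]` exists and is unique.) -/
def parallelTransport {ι : Type} [Fintype ι] [DecidableEq ι] (A : ℝ → Matrix ι ι ℂ) :
    Matrix ι ι ℂ :=
  if h : ∃ F, IsFundamentalSolution A F then h.choose 1 else 0

/-- The monodromy operator `T(σ_a)`, `a = 0, 1`, of the flat connection induced by `Ω` on the
quotient bundle: transport from `p` to `s_a p`, then identification of the fibre over `s_a p` with
the fibre over `p` through `s_a⁻¹ = s_a`. -/
def monodromy (m : ℕ) [NeZero m] (k α : Fin 2 → ℂ) (κ : ℂ) (a : Fin 2) :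
    Matrix (ZMod m) (ZMod m) ℂ :=
  reflMatrix m ((a : ℕ) : ZMod m) *
    parallelTransport (connectionAlong m k α κ ((a : ℕ) : ZMod m))

/-- `q = exp(κ π √-1 k)`. -/
def qOf (κ k : ℂ) : ℂ := Complex.exp (κ * Real.pi * Complex.I * k)

/-- `l = exp(κ π √-1 α) / q`. -/
def lOf (κ k α : ℂ) : ℂ := Complex.exp (κ * Real.pi * Complex.I * α) / qOf κ k

/-- `e_a = l_a / (q_a⁻¹ - q_a) (T(σ_a) - q_a) (T(σ_a) + q_a⁻¹)`. -/
def idem (m : ℕ) [NeZero m] (k α : Fin 2 → ℂ) (κ : ℂ) (a : Fin 2) :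
    Matrix (ZMod m) (ZMod m) ℂ :=
  (lOf κ (k a) (α a) / ((qOf κ (k a))⁻¹ - qOf κ (k a))) •
    ((monodromy m k α κ a - qOf κ (k a) • 1) * (monodromy m k α κ a + (qOf κ (k a))⁻¹ • 1))

/-- The operators attached to the letters: `X_a ↦ T(σ_a)`, `E_a ↦ e_a`. -/
def letterOp (m : ℕ) [NeZero m] (k α : Fin 2 → ℂ) (κ : ℂ) :
    Letter (Fin 2) → Matrix (ZMod m) (ZMod m) ℂ
  | .X a => monodromy m k α κ a
  | .E a => idem m k α κ a

/-- The morphism `f` from the free monoid on `X_0, X_1, E_0, E_1` to the operators. -/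
def wordOp (m : ℕ) [NeZero m] (k α : Fin 2 → ℂ) (κ : ℂ) :
    FreeMonoid (Letter (Fin 2)) →* Matrix (ZMod m) (ZMod m) ℂ :=
  FreeMonoid.lift (letterOp m k α κ)

open Classical in
/-- `Φ^a(w)` is the scalar `c` with `e_a f(w) e_a = c e_a`. It exists and is unique when `e_a` has
rank one, as it does for generic parameters; otherwise the value is `0` by convention. -/
def Phi (m : ℕ) [NeZero m] (k α : Fin 2 → ℂ) (κ : ℂ) (a : Fin 2)
    (w : FreeMonoid (Letter (Fin 2))) : ℂ :=
  if h : ∃! c : ℂ, idem m k α κ a * wordOp m k α κ w * idem m k α κ a = c • idem m k α κ a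
  then h.choose else 0

/-! ### The algebra of a Coxeter matrix -/

/-- The data `Π`: pairs `(k_i, α_i)` in `ℂˣ × ℂ`, equal for conjugate simple reflections. -/
structure Parameters {n : ℕ} (Γ : CoxeterMatrix (Fin n)) where
  k : Fin n → ℂ
  α : Fin n → ℂ
  k_ne_zero : ∀ i, k i ≠ 0
  k_conj : ∀ i j, IsConj (Γ.simple i) (Γ.simple j) → k i = k j
  α_conj : ∀ i j, IsConj (Γ.simple i) (Γ.simple j) → α i = α j

/-- `q_i`. -/
def Parameters.q {n : ℕ} {Γ : CoxeterMatrix (Fin n)} (P : Parameters Γ) (κ : ℂ) (i : Fin n) : ℂ :=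
  qOf κ (P.k i)

/-- `l_i`. -/
def Parameters.l {n : ℕ} {Γ : CoxeterMatrix (Fin n)} (P : Parameters Γ) (κ : ℂ) (i : Fin n) : ℂ :=
  lOf κ (P.k i) (P.α i)

/-- The function `Φ` on the words in `X_i, E_i, X_j, E_j`, with `(i, j)` in the roles of `(0, 1)`
and with the constants `Π_{i,j}`; the case `a = 0` is `Φ^i` and the case `a = 1` is `Φ^j`. -/
def Parameters.Phi {n : ℕ} {Γ : CoxeterMatrix (Fin n)} (P : Parameters Γ) (κ : ℂ) (i j : Fin n)
    [NeZero (Γ i j)] (a : Fin 2) (w : FreeMonoid (Letter (Fin 2))) : ℂ :=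
  BMW.Phi (Γ i j) ![P.k i, P.k j] ![P.α i, P.α j] κ a w

/-- The generators `X_i`, `X_i⁻`, `E_i`. -/
inductive Gen (n : ℕ) : Type
  | X (i : Fin n) : Gen n
  | Xinv (i : Fin n) : Gen n
  | E (i : Fin n) : Gen n

/-- `X_i` in the free algebra. -/
def gX {n : ℕ} (i : Fin n) : FreeAlgebra ℂ (Gen n) := FreeAlgebra.ι ℂ (Gen.X i)

/-- `X_i⁻` in the free algebra. -/
def gXinv {n : ℕ} (i : Fin n) : FreeAlgebra ℂ (Gen n) := FreeAlgebra.ι ℂ (Gen.Xinv i)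

/-- `E_i` in the free algebra. -/
def gE {n : ℕ} (i : Fin n) : FreeAlgebra ℂ (Gen n) := FreeAlgebra.ι ℂ (Gen.E i)

/-- A letter as an element of the free algebra. -/
def letterGen {n : ℕ} : Letter (Fin n) → FreeAlgebra ℂ (Gen n)
  | .X i => gX i
  | .E i => gE i

/-- A word in the letters as an element of the free algebra. -/
def wordGen {n : ℕ} : FreeMonoid (Letter (Fin n)) →* FreeAlgebra ℂ (Gen n) :=
  FreeMonoid.lift letterGen

/-- The letter obtained by substituting the index `i` for `0` and `j` for `1`. -/
def Letter.subst {n : ℕ} (i j : Fin n) : Letter (Fin 2) → Letter (Fin n)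
  | .X a => .X (![i, j] a)
  | .E a => .E (![i, j] a)

/-- A word in `X_0, X_1, E_0, E_1` as a word in `X_i, X_j, E_i, E_j` in the free algebra. -/
def wordPair {n : ℕ} (i j : Fin n) (w : FreeMonoid (Letter (Fin 2))) : FreeAlgebra ℂ (Gen n) :=
  wordGen (FreeMonoid.map (Letter.subst i j) w)

/-- The alternating product `[x y x ⋯]` with `m` factors. -/
def altProd {A : Type} [Monoid A] : A → A → ℕ → A
  | _, _, 0 => 1
  | x, y, m + 1 => x * altProd y x m

/-- The defining relations. An entry `0` of a Mathlib Coxeter matrix stands for `∞`; such a pair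
`i, j` carries no relation. -/
inductive Rel {n : ℕ} (Γ : CoxeterMatrix (Fin n)) (P : Parameters Γ) (κ : ℂ) :
    FreeAlgebra ℂ (Gen n) → FreeAlgebra ℂ (Gen n) → Prop
  | X_mul_Xinv (i : Fin n) : Rel Γ P κ (gX i * gXinv i) 1
  | Xinv_mul_X (i : Fin n) : Rel Γ P κ (gXinv i * gX i) 1
  | braid (i j : Fin n) (hij : i ≠ j) :
      Rel Γ P κ (altProd (gX i) (gX j) (Γ i j)) (altProd (gX j) (gX i) (Γ i j))
  | quadratic (i : Fin n) :
      Rel Γ P κ (((P.q κ i)⁻¹ - P.q κ i) • gE i)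
        (P.l κ i • ((gX i - P.q κ i • 1) * (gX i + (P.q κ i)⁻¹ • 1)))
  | X_mul_E (i : Fin n) : Rel Γ P κ (gX i * gE i) ((P.l κ i)⁻¹ • gE i)
  | E_mul_X (i : Fin n) : Rel Γ P κ (gE i * gX i) ((P.l κ i)⁻¹ • gE i)
  | sandwich_left (i j : Fin n) (hij : i < j) [NeZero (Γ i j)] (w : FreeMonoid (Letter (Fin 2))) :
      Rel Γ P κ (gE i * wordPair i j w * gE i) (P.Phi κ i j 0 w • gE i)
  | sandwich_right (i j : Fin n) (hij : i < j) [NeZero (Γ i j)] (w : FreeMonoid (Letter (Fin 2))) :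
      Rel Γ P κ (gE j * wordPair i j w * gE j) (P.Phi κ i j 1 w • gE j)
  | mixed (i j : Fin n) (hij : i ≠ j) (heven : Even (Γ i j)) (hgt : 2 < Γ i j)
      (w : FreeMonoid (Letter (Fin 2))) :
      Rel Γ P κ (gE i * wordPair i j w * gE j) 0

/-- The algebra `B_Γ(Π, κ)`. -/
abbrev BMWAlgebra {n : ℕ} (Γ : CoxeterMatrix (Fin n)) (P : Parameters Γ) (κ : ℂ) : Type :=
  RingQuot (Rel Γ P κ)

/-- The element of `B_Γ(Π, κ)` represented by a word in the `X_i`, `E_i`. -/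
def wordElem {n : ℕ} (Γ : CoxeterMatrix (Fin n)) (P : Parameters Γ) (κ : ℂ)
    (w : FreeMonoid (Letter (Fin n))) : BMWAlgebra Γ P κ :=
  RingQuot.mkAlgHom ℂ (Rel Γ P κ) (wordGen w)

end BMW

end

/-!
Write `P_i` for the span of `X_i` and `E_i`, and `L_k` for the span of the words of length at most
`k` in the letters `X_i`, `E_i`; so `L_k` is the `k`-th power of `L_1`. To a word `ω = i_1 ⋯ i_k` in
the simple reflections belongs the space `P_{i_1} ⋯ P_{i_k}`. It depends, modulo `L_{k-1}`, only on
the class of `ω` under braid moves, and it is contained in `L_{k-1}` if `ω` has two equal adjacent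
letters, because `P_i P_i ⊆ L_1`. By Matsumoto's theorem every non-reduced word can be brought into
such a form. As a word longer than the longest element `w₀` is never reduced, `L_{N+1} = L_N` for `N
= ℓ(w₀)`, and `L_N` is the whole algebra, since `X_i⁻¹` is a combination of `1`, `X_i`, `E_i`.

Matsumoto's theorem (`CoxeterSystem.IsReduced.reflTransGen_braidMove`) is proved here from the
exchange property and from the fact that `s_i s_j` has exactly the order `m_{ij}`, which is read off
from the geometric representation.

The heart of the matter is the invariance under braid moves
(`BMW.DihedralRelations.alt_pair_le_alt_pair`): for `m = m_{ij}`, the alternating product `P_i P_j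
P_i ⋯` with `m` factors is contained in `L_{m-1} + P_j P_i P_j ⋯`. For `m = 2` the two pairs of
letters commute, and now let `m ≥ 3`. For the word `X_i X_j X_i ⋯` this is the braid relation. The
other words contain some `E`; write `B` for the algebra generated by the four letters, with indices
`a ∈ ℤ/2`. The sandwich relations, together with the vanishing of `E_i B E_j` for even `m` and the
conjugacy of `E_i` and `E_j` for odd `m`, show that `B E_a` is spanned by the products `⋯ X_a
X_{a+1} E_a` with less than `m` factors `X`. This reduces everything to words `u E_a v` with
alternating products `u`, `v` of the `X`, and the left ideals `M_t = ∑_a B E_a L_{t-1}` serve for an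
induction on the length `t` of `v`. If `2t ≥ m`, then `E_a v` is moved across the half twist `D`,
the alternating product of length `m - 1` that satisfies `E_a D = D E_{a+m}`, and lands in `M_t`. If
`2t < m`, then modulo `M_t` all factors of `v` may be replaced by their inverses; now `u E_a v` can
be completed to contain `D`, and moving `D` across `E_a` turns a word of length `l` into one of
length `2m - l` on the other side of the dihedral group. This is short for `l > m`, and for `l = m`
it is an alternating word that begins with the other index.

The values of the functions `Φ` play no role: it only matters that `E_i w E_i` is a multiple of
`E_i`.
-/

/-! ### The order of a product of two simple reflections -/

namespace CoxeterMatrix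

open Real Polynomial.Chebyshev

variable {ι : Type*} [Fintype ι] [DecidableEq ι] (M : CoxeterMatrix ι)

/-- The linear form `v ↦ ∑ j, -2 cos (π / m_{ij}) v_j`, that is, twice the form `B(e_i, ·)` of the
geometric representation. An entry `0` of `M`, which stands for `∞`, gives the value
`-2 cos 0 = -2`, as it should. -/
noncomputable def geometricCoroot (i : ι) : Module.Dual ℝ (ι → ℝ) :=
  ∑ j, (-2 * cos (π / M i j)) • LinearMap.proj j

lemma geometricCoroot_single (i j : ι) :
    M.geometricCoroot i (Pi.single j 1) = -2 * cos (π / M i j) := by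
  simp [geometricCoroot, Pi.single_apply]

lemma geometricCoroot_single_self (i : ι) : M.geometricCoroot i (Pi.single i 1) = 2 := by
  simp [geometricCoroot_single]

/-- The reflections of the geometric representation. -/
noncomputable def geometricReflection (i : ι) : (ι → ℝ) ≃ₗ[ℝ] (ι → ℝ) :=
  Module.reflection (M.geometricCoroot_single_self i)

lemma geometricCoroot_mul (i j : ι) :
    M.geometricCoroot i (Pi.single j 1) * M.geometricCoroot j (Pi.single i 1) - 2 =
      2 * cos (2 * π / M i j) := by
  rw [geometricCoroot_single, geometricCoroot_single, M.symmetric j i, mul_div_assoc, cos_two_mul]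
  ring

lemma sin_two_pi_div_pos {m : ℕ} (hm : 3 ≤ m) : 0 < sin (2 * π / m) := by
  have h3 : (3 : ℝ) ≤ m := by exact_mod_cast hm
  apply sin_pos_of_pos_of_lt_pi
  · have := pi_pos
    positivity
  · rw [div_lt_iff₀ (by linarith)]
    nlinarith [pi_pos]

lemma isLiftable_geometricReflection : M.IsLiftable M.geometricReflection := by
  intro i j
  rcases eq_or_ne i j with rfl | hij
  · rw [M.diagonal, pow_one]
    ext1 z
    exact Module.involutive_reflection (M.geometricCoroot_single_self i) z
  have h1 : M i j ≠ 1 := M.off_diagonal i j hij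
  ext1 z
  rw [geometricReflection, geometricReflection, Module.reflection_mul_reflection_pow_apply _ _ _ _
    _ (M.geometricCoroot_mul i j).symm, M.geometricCoroot_single i j, M.geometricCoroot_single j i,
    M.symmetric j i, LinearEquiv.coe_one, id]
  generalize M i j = m at h1
  have hS := fun n : ℤ ↦ S_two_mul_real_cos (2 * π / m) n
  rcases lt_or_ge m 3 with hm | hm
  · interval_cases m
    · simp
    · simp at h1
    · norm_num
      abel
  have hs := (sin_two_pi_div_pos hm).ne'
  have hm0 : (m : ℝ) ≠ 0 := by positivity
  obtain ⟨p, rfl | rfl⟩ := m.even_or_odd'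
  · have e1 : (((2 * p : ℕ) : ℤ) - 2) / 2 = p - 1 := by omega
    have e2 : (((2 * p : ℕ) : ℤ) - 1) / 2 = p - 1 := by omega
    have h0 : (S ℝ (p - 1)).eval (2 * cos (2 * π / (2 * p : ℕ))) = 0 := by
      refine (mul_eq_zero.1 ((hS _).trans ?_)).resolve_right hs
      have : (((p : ℤ) - 1 : ℤ) + 1 : ℝ) * (2 * π / (2 * p : ℕ)) = π := by
        have hp0 : (p : ℝ) ≠ 0 := by simpa using hm0
        push_cast
        field_simp
        ring
      rw [this, sin_pi]
    simp only [e1, e2, h0]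
    simp
  · have e1 : (((2 * p + 1 : ℕ) : ℤ) - 2) / 2 = p - 1 := by omega
    have e2 : (((2 * p + 1 : ℕ) : ℤ) - 1) / 2 = p := by omega
    have e3 : (((2 * p + 1 : ℕ) : ℤ) - 3) / 2 = p - 1 := by omega
    have e4 : (((2 * p + 1 : ℕ) : ℤ)) / 2 = p := by omega
    have h0 : (S ℝ p).eval (2 * cos (2 * π / (2 * p + 1 : ℕ))) +
        (S ℝ (p - 1)).eval (2 * cos (2 * π / (2 * p + 1 : ℕ))) = 0 := by
      refine (mul_eq_zero.1 (Eq.trans ?_ (add_neg_cancel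
        (sin ((p : ℝ) * (2 * π / (2 * p + 1 : ℕ))))))).resolve_right hs
      have : ((p : ℤ) + 1 : ℝ) * (2 * π / (2 * p + 1 : ℕ)) =
          2 * π - (p : ℝ) * (2 * π / (2 * p + 1 : ℕ)) := by
        push_cast at hm0 ⊢
        field_simp
        ring
      rw [add_mul, hS, hS, this, sin_two_pi_sub, add_comm]
      push_cast
      ring_nf
    simp only [e1, e2, e3, e4, h0]
    simp

end CoxeterMatrix

namespace CoxeterSystem

open Real Polynomial.Chebyshev CoxeterMatrix

variable {ι : Type*} {W : Type*} [Group W] {M : CoxeterMatrix ι} (cs : CoxeterSystem M W)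

/-- The product of two simple reflections has the order prescribed by the Coxeter matrix. In the
geometric representation, the coefficients of `(s_i s_j)^q e_i` are values of Chebyshev
polynomials at `2 cos (2π / m_{ij})`. -/
theorem simple_mul_simple_pow_ne_one [Fintype ι] {i j : ι} (hij : i ≠ j) {q : ℕ} (hq : 0 < q)
    (hqm : M i j = 0 ∨ q < M i j) : (cs.simple i * cs.simple j) ^ q ≠ 1 := by
  classical
  intro h
  have h1 : M i j ≠ 1 := M.off_diagonal i j hij
  have h2 := congrArg (cs.lift ⟨_, M.isLiftable_geometricReflection⟩) h
  rw [map_pow, map_mul, cs.lift_apply_simple, cs.lift_apply_simple, map_one] at h2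
  replace h2 := LinearEquiv.congr_fun h2 (Pi.single i 1)
  rw [geometricReflection, geometricReflection, Module.reflection_mul_reflection_pow_apply_self _ _
    _ _ (M.geometricCoroot_mul i j).symm] at h2
  have hi := congrFun h2 i
  have hj := congrFun h2 j
  simp only [geometricCoroot_single, M.symmetric j i, Pi.add_apply, Pi.smul_apply,
    Pi.single_eq_same, Pi.single_eq_of_ne hij, Pi.single_eq_of_ne hij.symm, smul_eq_mul,
    LinearEquiv.coe_one, id, mul_one, mul_zero, add_zero, zero_add] at hi hj
  generalize M i j = m at h1 hqm hi hj
  have hS := fun n : ℤ ↦ S_two_mul_real_cos (2 * π / m) n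
  rcases lt_or_ge m 3 with hm | hm
  · interval_cases m
    · norm_num [S_eval_two] at hj
      omega
    · simp at h1
    · obtain rfl : q = 1 := by omega
      norm_num at hi
  have hs := (sin_two_pi_div_pos hm).ne'
  have hm0 : (m : ℝ) ≠ 0 := by positivity
  have hc : cos (π / m) ≠ 0 := by
    intro hc
    apply hs
    rw [mul_div_assoc, sin_two_mul, hc, mul_zero]
  have hj' : (S ℝ (q - 1)).eval (2 * cos (2 * π / m)) = 0 := by
    refine (mul_eq_zero.1 hj).resolve_right ?_
    simpa using hc
  have hsin : sin (q * (2 * π / m)) = 0 := by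
    have := hS (q - 1)
    rw [hj', zero_mul] at this
    rw [this]
    push_cast
    ring_nf
  obtain ⟨k, hk⟩ := sin_eq_zero_iff.1 hsin
  have hk' : (k : ℝ) * m = 2 * q := by
    have := pi_ne_zero
    field_simp at hk
    linarith
  have hk'' : k * m = 2 * q := by exact_mod_cast hk'
  -- since `0 < q < m`, the only possibility is `m = 2 q`
  have hk1 : k = 1 := by
    have hqm' : (q : ℤ) < m := by exact_mod_cast hqm.resolve_left (by omega)
    have : 0 < k := by
      by_contra hk0
      nlinarith
    have : k < 2 := by
      by_contra hk0
      nlinarith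
    omega
  rw [hj', add_zero] at hi
  have := hS q
  rw [hi, one_mul] at this
  push_cast at this
  rw [add_mul, one_mul, ← hk, hk1, Int.cast_one, one_mul, add_comm, sin_add_pi] at this
  exact hs (by linarith)

end CoxeterSystem

/-! ### The exchange property and Matsumoto's theorem -/

namespace CoxeterSystem

variable {ι : Type*} {W : Type*} [Group W] {M : CoxeterMatrix ι} (cs : CoxeterSystem M W)

lemma _root_.Function.End.mul_apply {α : Type*} (f g : Function.End α) (a : α) :
    (f * g) a = f (g a) := rfl

lemma _root_.Function.End.one_apply {α : Type*} (a : α) : (1 : Function.End α) a = a := rfl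

open Classical in
/-- The map `(t, ε) ↦ (s_i t s_i, ε + [t = s_i])` of `W × ℤ/2`. For a word `ω`, the composition of
these maps counts modulo 2 how often an element of `W` occurs in the right inversion sequence
of `ω`; that these maps satisfy the Coxeter relations shows that this parity depends on the product
of `ω` only. -/
noncomputable def parityMap (i : ι) : Function.End (W × ZMod 2) :=
  fun p ↦ (cs.simple i * p.1 * cs.simple i, p.2 + if p.1 = cs.simple i then 1 else 0)

open Classical in
lemma parityMap_mul_pow (i j : ι) (k : ℕ) (p : W × ZMod 2) :
    ((cs.parityMap i * cs.parityMap j) ^ k) p =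
      ((cs.simple i * cs.simple j) ^ k * p.1 * (cs.simple j * cs.simple i) ^ k,
        p.2 + ∑ l ∈ Finset.range (2 * k),
          if p.1 = cs.simple j * (cs.simple i * cs.simple j) ^ l then 1 else 0) := by
  induction k with
  | zero => simp [Function.End.one_apply]
  | succ k ih =>
    have hinv : ((cs.simple i * cs.simple j) ^ k)⁻¹ = (cs.simple j * cs.simple i) ^ k := by
      rw [← inv_pow, mul_inv_rev, cs.inv_simple, cs.inv_simple]
    have hji : (cs.simple j * cs.simple i) ^ k * cs.simple j =
        cs.simple j * (cs.simple i * cs.simple j) ^ k := mul_pow_mul _ _ _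
    have h1 : (cs.simple i * cs.simple j) ^ k * p.1 * (cs.simple j * cs.simple i) ^ k =
        cs.simple j ↔ p.1 = cs.simple j * (cs.simple i * cs.simple j) ^ (2 * k) := by
      rw [← hinv, mul_inv_eq_iff_eq_mul, ← eq_inv_mul_iff_mul_eq, hinv, ← mul_assoc, hji, mul_assoc,
        ← pow_add, two_mul]
    have h2 : cs.simple j * ((cs.simple i * cs.simple j) ^ k * p.1 *
        (cs.simple j * cs.simple i) ^ k) * cs.simple j = cs.simple i ↔
        p.1 = cs.simple j * (cs.simple i * cs.simple j) ^ (2 * k + 1) := by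
      rw [← eq_mul_inv_iff_mul_eq, ← eq_inv_mul_iff_mul_eq, cs.inv_simple, ← hinv,
        mul_inv_eq_iff_eq_mul, ← eq_inv_mul_iff_mul_eq, hinv, ← mul_assoc, ← mul_assoc, hji,
        mul_assoc, mul_assoc, ← pow_succ', ← pow_add,
        show k + (k + 1) = 2 * k + 1 by ring]
    rw [pow_succ', Function.End.mul_apply, ih, Function.End.mul_apply, parityMap, parityMap]
    dsimp only
    rw [mul_add, mul_one, Finset.sum_range_succ, Finset.sum_range_succ]
    simp only [h1, h2]
    refine Prod.ext ?_ ?_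
    · simp only [pow_succ' (cs.simple i * cs.simple j), pow_succ (cs.simple j * cs.simple i),
        mul_assoc]
    · simp only [add_assoc]

lemma isLiftable_parityMap : M.IsLiftable cs.parityMap := by
  classical
  intro i j
  funext p
  rw [parityMap_mul_pow, simple_mul_simple_pow, simple_mul_simple_pow', two_mul,
    Finset.sum_range_add]
  simp only [pow_add, simple_mul_simple_pow, one_mul]
  rw [CharTwo.add_self_eq_zero]
  simp [Function.End.one_apply]

open Classical in
lemma lift_parityMap_wordProd (ω : List ι) (p : W × ZMod 2) :
    cs.lift ⟨_, cs.isLiftable_parityMap⟩ (cs.wordProd ω) p =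
      (cs.wordProd ω * p.1 * (cs.wordProd ω)⁻¹, p.2 + (cs.rightInvSeq ω).count p.1) := by
  induction ω generalizing p with
  | nil => simp [Function.End.one_apply]
  | cons i ω ih =>
    rw [wordProd_cons, map_mul, Function.End.mul_apply, ih, cs.lift_apply_simple,
      parityMap, rightInvSeq, List.count_cons]
    refine Prod.ext ?_ ?_
    · simp [mul_assoc]
    · have : cs.wordProd ω * p.1 * (cs.wordProd ω)⁻¹ = cs.simple i ↔
          (cs.wordProd ω)⁻¹ * cs.simple i * cs.wordProd ω = p.1 := by
        rw [mul_inv_eq_iff_eq_mul, ← eq_inv_mul_iff_mul_eq, eq_comm, mul_assoc]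
      simp only [this, beq_iff_eq]
      push_cast
      rw [add_assoc]

/-- The exchange property in terms of inversion sequences: a right descent of the product of a word
(reduced or not) occurs in its right inversion sequence. -/
theorem simple_mem_rightInvSeq {ω : List ι} {i : ι} (h : cs.IsRightDescent (cs.wordProd ω) i) :
    cs.simple i ∈ cs.rightInvSeq ω := by
  classical
  obtain ⟨ω', hω', hw⟩ := cs.exists_isReduced (cs.wordProd ω * cs.simple i)
  have hprod : cs.wordProd ω = cs.wordProd (ω'.concat i) := by
    rw [wordProd_concat, ← hw, simple_mul_simple_cancel_right]
  have h0 : (cs.rightInvSeq ω').count (cs.simple i) = 0 := by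
    rw [List.count_eq_zero]
    intro hmem
    have := (cs.isRightInversion_of_mem_rightInvSeq hω' hmem).2
    rw [← hw, simple_mul_simple_cancel_right] at this
    exact lt_asymm this h
  have h1 : ((cs.rightInvSeq ω).count (cs.simple i) : ZMod 2) = 1 := by
    have h2 := cs.lift_parityMap_wordProd ω (cs.simple i, 0)
    rw [hprod, lift_parityMap_wordProd] at h2
    replace h2 := (Prod.ext_iff.1 h2).2
    dsimp only at h2
    rw [zero_add, zero_add, rightInvSeq_concat, List.concat_eq_append, List.count_append,
      List.count_singleton_self] at h2
    have h4 : MulAut.conj (cs.simple i) (cs.simple i) = cs.simple i := by simp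
    nth_rw 1 [← h4] at h2
    rw [List.count_map_of_injective _ _ (MulAut.conj (cs.simple i)).injective, h0] at h2
    rw [← h2]
    simp
  by_contra hmem
  rw [List.count_eq_zero.2 hmem] at h1
  simp at h1

/-- The exchange property. -/
theorem exists_eraseIdx_of_isLeftDescent {ω : List ι} {i : ι}
    (h : cs.IsLeftDescent (cs.wordProd ω) i) :
    ∃ p < ω.length, cs.simple i * cs.wordProd ω = cs.wordProd (ω.eraseIdx p) := by
  rw [← isRightDescent_inv_iff, ← wordProd_reverse] at h
  have hmem := cs.simple_mem_rightInvSeq h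
  rw [rightInvSeq_reverse, List.mem_reverse] at hmem
  obtain ⟨p, hp, hpi⟩ := List.mem_iff_getElem.1 hmem
  refine ⟨p, by simpa using hp, ?_⟩
  rw [← getD_leftInvSeq_mul_wordProd, List.getD_eq_getElem _ 1 hp, hpi]

end CoxeterSystem

namespace CoxeterMatrix

variable {ι : Type*}

/-- The word `i j i ⋯` with `k` letters. (`CoxeterSystem.alternatingWord` prescribes the last letter
instead of the first.) -/
def altWord : ι → ι → ℕ → List ι
  | _, _, 0 => []
  | i, j, k + 1 => i :: altWord j i k

@[simp]
lemma length_altWord (i j : ι) (k : ℕ) : (altWord i j k).length = k := by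
  induction k generalizing i j with
  | zero => rfl
  | succ k ih => simp [altWord, ih]

lemma exists_altWord_add (i j : ι) (k l : ℕ) :
    ∃ ω, altWord i j (k + l) = altWord i j k ++ ω := by
  induction k generalizing i j with
  | zero => exact ⟨_, rfl⟩
  | succ k ih =>
    obtain ⟨ω, hω⟩ := ih j i
    exact ⟨ω, by rw [Nat.add_right_comm, altWord, altWord, hω, List.cons_append]⟩

/-- One application of a braid relation to a word. -/
inductive BraidMove (M : CoxeterMatrix ι) : List ι → List ι → Prop
  | mk (a b : List ι) (i j : ι) (hij : i ≠ j) (hM : M i j ≠ 0) :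
      BraidMove M (a ++ altWord i j (M i j) ++ b) (a ++ altWord j i (M i j) ++ b)

lemma BraidMove.cons {M : CoxeterMatrix ι} {ω ω' : List ι} (h : M.BraidMove ω ω') (i : ι) :
    M.BraidMove (i :: ω) (i :: ω') := by
  obtain ⟨a, b, j, k, hij, hM⟩ := h
  exact ⟨i :: a, b, j, k, hij, hM⟩

lemma BraidMove.reflTransGen_cons {M : CoxeterMatrix ι} {ω ω' : List ι}
    (h : Relation.ReflTransGen M.BraidMove ω ω') (i : ι) :
    Relation.ReflTransGen M.BraidMove (i :: ω) (i :: ω') :=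
  h.lift (i :: ·) fun _ _ h ↦ h.cons i

end CoxeterMatrix

namespace CoxeterSystem

open CoxeterMatrix Relation

variable {ι : Type*} {W : Type*} [Group W] {M : CoxeterMatrix ι} (cs : CoxeterSystem M W)

lemma wordProd_altWord_eq_pow_mul (i j : ι) (k : ℕ) :
    cs.wordProd (altWord i j k) =
      (cs.simple i * cs.simple j) ^ k * cs.wordProd (altWord j i k) := by
  induction k generalizing i j with
  | zero => simp [altWord]
  | succ k ih =>
    rw [altWord, altWord, wordProd_cons, wordProd_cons, ih j i, ← mul_assoc,
      ← mul_pow_mul (cs.simple i), pow_succ]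
    simp [mul_assoc]

variable {cs}

lemma IsReduced.isLeftDescent_cons {i : ι} {ω : List ι} (h : cs.IsReduced (i :: ω)) :
    cs.IsLeftDescent (cs.wordProd (i :: ω)) i := by
  rw [IsLeftDescent, h.eq, wordProd_cons, simple_mul_simple_cancel_left, List.length_cons]
  exact Nat.lt_succ_of_le (cs.length_wordProd_le ω)

/-- An element with the left descents `i ≠ j` has a reduced word beginning with the alternating
word in `i` and `j` of length `k`, as long as `k ≤ m_{ij}`. -/
lemma exists_altWord_append [Fintype ι] {w : W} {i j : ι} (hij : i ≠ j)
    (hi : cs.IsLeftDescent w i) (hj : cs.IsLeftDescent w j) (k : ℕ)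
    (hk : M i j = 0 ∨ k ≤ M i j) :
    ∃ ω, cs.IsReduced (altWord i j k ++ ω) ∧ cs.wordProd (altWord i j k ++ ω) = w := by
  induction k generalizing i j with
  | zero =>
    obtain ⟨ω, hω, h⟩ := cs.exists_isReduced w
    exact ⟨ω, hω, h.symm⟩
  | succ k ih =>
    obtain ⟨ω, hω, rfl⟩ := ih hij.symm hj hi (by rw [M.symmetric]; omega)
    obtain ⟨p, hp, hpw⟩ := cs.exists_eraseIdx_of_isLeftDescent hi
    have key : cs.wordProd (i :: (altWord j i k ++ ω).eraseIdx p) =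
        cs.wordProd (altWord j i k ++ ω) := by
      rw [wordProd_cons, ← hpw, simple_mul_simple_cancel_left]
    rcases lt_or_ge p k with hpk | hpk
    · -- deleting a letter of the alternating prefix would give a relation shorter than `m_{ij}`
      exfalso
      obtain ⟨l, rfl⟩ : ∃ l, k = p + 1 + l := ⟨k - (p + 1), by omega⟩
      obtain ⟨ω₁, h₁⟩ := exists_altWord_add j i (p + 1) l
      obtain ⟨ω₂, h₂⟩ := exists_altWord_add j i p 1
      have hlen : ω₂.length = 1 := by
        have := congrArg List.length h₂
        simpa using this.symm
      obtain ⟨y, rfl⟩ := List.length_eq_one_iff.1 hlen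
      have h₃ : cs.simple i * cs.wordProd (altWord j i (p + 1)) = cs.wordProd (altWord j i p) := by
        rw [List.eraseIdx_append_of_lt_length (by simpa using hpk), h₁, h₂,
          List.eraseIdx_append_of_lt_length (by simp),
          List.eraseIdx_append_of_length_le (by simp)] at hpw
        simp only [length_altWord, Nat.sub_self, List.eraseIdx_cons_zero, List.append_nil,
          wordProd_append] at hpw
        rw [h₂, wordProd_append]
        simpa [← mul_assoc] using hpw
      rw [altWord, wordProd_cons, wordProd_altWord_eq_pow_mul, ← mul_assoc, ← mul_assoc,
        ← pow_succ'] at h₃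
      exact cs.simple_mul_simple_pow_ne_one hij (Nat.succ_pos p) (by omega) (mul_eq_right.1 h₃)
    · rw [List.eraseIdx_append_of_length_le (by simpa using hpk), length_altWord] at key
      refine ⟨ω.eraseIdx (p - k), ?_, key⟩
      have hlen := List.length_eraseIdx_of_lt (l := ω) (i := p - k) (by simp at hp; omega)
      have hω' := hω.eq
      rw [IsReduced]
      change cs.length (cs.wordProd (i :: (altWord j i k ++ _))) =
        (i :: (altWord j i k ++ _)).length
      rw [key, hω']
      simp at hp ⊢
      omega

/-- Matsumoto's theorem: two reduced words of the same element are connected by braid moves. -/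
theorem IsReduced.reflTransGen_braidMove [Fintype ι] {ω ω' : List ι} (hω : cs.IsReduced ω)
    (hω' : cs.IsReduced ω') (h : cs.wordProd ω = cs.wordProd ω') :
    ReflTransGen M.BraidMove ω ω' := by
  induction hN : ω.length generalizing ω ω' with
  | zero =>
    rw [List.length_eq_zero_iff] at hN
    subst hN
    have : ω'.length = 0 := by rw [← hω'.eq, ← h]; simp
    rw [List.length_eq_zero_iff.1 this]
  | succ N ih =>
    have hlen : ω'.length = N + 1 := by rw [← hω'.eq, ← h, hω.eq, hN]
    have same {i : ι} {ω₁ ω₂ : List ι} (h₁ : cs.IsReduced (i :: ω₁)) (h₂ : cs.IsReduced (i :: ω₂))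
        (h : cs.wordProd (i :: ω₁) = cs.wordProd (i :: ω₂)) (hl : (i :: ω₁).length = N + 1) :
        ReflTransGen M.BraidMove (i :: ω₁) (i :: ω₂) := by
      apply BraidMove.reflTransGen_cons
      refine ih (h₁.drop 1) (h₂.drop 1) ?_ (by simpa using hl)
      rw [wordProd_cons, wordProd_cons] at h
      exact mul_left_cancel h
    match ω, ω', hN, hlen with
    | i :: ω₁, j :: ω₂, hN, hlen =>
      rcases eq_or_ne i j with rfl | hij
      · exact same hω hω' h hN
      have hi := hω.isLeftDescent_cons
      have hj := hω'.isLeftDescent_cons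
      rw [← h] at hj
      have hM : M i j ≠ 0 := by
        intro hM
        obtain ⟨ω₃, h₃, h₄⟩ := exists_altWord_append hij hi hj (N + 2) (Or.inl hM)
        have := h₃.eq
        rw [h₄, hω.eq, hN] at this
        simp at this
        omega
      obtain ⟨m, hm⟩ := Nat.exists_eq_succ_of_ne_zero hM
      obtain ⟨ω₃, h₃, h₄⟩ := exists_altWord_append hij hi hj (M i j) (Or.inr le_rfl)
      have hb : M.BraidMove (altWord i j (M i j) ++ ω₃) (altWord j i (M i j) ++ ω₃) :=
        ⟨[], ω₃, i, j, hij, hM⟩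
      have hb' : cs.wordProd (altWord j i (M i j) ++ ω₃) = cs.wordProd (i :: ω₁) := by
        rw [← h₄, wordProd_append, wordProd_append, cs.wordProd_altWord_eq_pow_mul i j,
          simple_mul_simple_pow, one_mul]
      have hr : cs.IsReduced (altWord j i (M i j) ++ ω₃) := by
        rw [IsReduced, hb', ← h₄, h₃.eq]
        simp
      rw [hm] at h₃ h₄ hb hb' hr
      exact (same hω h₃ h₄.symm hN).trans (.head hb (same hr hω' (hb'.trans h) (by
        have := hr.eq
        rw [hb', hω.eq, hN] at this
        exact this.symm)))

/-- A word that is not reduced can be brought by braid moves into a form with two equal adjacent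
letters. -/
theorem exists_reflTransGen_braidMove_of_not_isReduced [Fintype ι] {ω : List ι}
    (hω : ¬ cs.IsReduced ω) :
    ∃ (a : List ι) (i : ι) (b : List ι), ReflTransGen M.BraidMove ω (a ++ i :: i :: b) := by
  induction ω with
  | nil => exact absurd (by simp [IsReduced]) hω
  | cons i ω ih =>
    by_cases h : cs.IsReduced ω
    · have hi : cs.IsLeftDescent (cs.wordProd ω) i := by
        by_contra hi
        rw [cs.not_isLeftDescent_iff, ← wordProd_cons, h.eq] at hi
        exact hω hi
      obtain ⟨ω', h', hw⟩ := cs.exists_isReduced (cs.simple i * cs.wordProd ω)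
      have hw' : cs.wordProd ω = cs.wordProd (i :: ω') := by
        rw [wordProd_cons, ← hw, simple_mul_simple_cancel_left]
      have hr : cs.IsReduced (i :: ω') := by
        rw [IsReduced, ← hw', List.length_cons, ← h'.eq, ← hw]
        exact (cs.isLeftDescent_iff.1 hi).symm
      exact ⟨[], i, ω', BraidMove.reflTransGen_cons (h.reflTransGen_braidMove hr hw') i⟩
    · obtain ⟨a, j, b, hb⟩ := ih h
      exact ⟨i :: a, j, b, BraidMove.reflTransGen_cons hb i⟩

variable (cs) in
/-- If `m_{ij}` is odd then `s_i` and `s_j` are conjugate. -/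
lemma isConj_simple_of_odd {i j : ι} (h : Odd (M i j)) : IsConj (cs.simple i) (cs.simple j) := by
  obtain ⟨p, hp⟩ := h
  have h1 := cs.simple_mul_simple_pow i j
  rw [hp, pow_succ, two_mul, pow_add] at h1
  have h2 : cs.simple j * (cs.simple i * cs.simple j) ^ p * cs.simple j =
      (cs.simple j * cs.simple i) ^ p := by
    rw [← mul_pow_mul]
    simp
  refine isConj_iff.2 ⟨(cs.simple i * cs.simple j) ^ p, ?_⟩
  have h3 : ((cs.simple i * cs.simple j) ^ p)⁻¹ = (cs.simple j * cs.simple i) ^ p := by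
    rw [← inv_pow, mul_inv_rev, cs.inv_simple, cs.inv_simple]
  rw [h3, ← h2]
  have h4 : (cs.simple i * cs.simple j) ^ p * cs.simple i * cs.simple j *
      (cs.simple i * cs.simple j) ^ p = 1 := by
    rw [mul_assoc _ (cs.simple i), ← pow_succ, pow_succ', mul_assoc, ← pow_add]
    rw [← pow_add, ← pow_succ] at h1
    rwa [← pow_succ']
  calc _ = ((cs.simple i * cs.simple j) ^ p * cs.simple i * cs.simple j *
      (cs.simple i * cs.simple j) ^ p) * cs.simple j := by simp only [mul_assoc]
    _ = _ := by rw [h4, one_mul]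

end CoxeterSystem

/-! ### Alternating products -/

namespace BMW

lemma zmod_two_eq_or (a b : ZMod 2) : a = b ∨ a = b + 1 := by
  revert a b
  decide

lemma zmod_two_two : (2 : ZMod 2) = 0 := rfl

section Alternating

variable {A : Type*} [Monoid A] (x : ZMod 2 → A)

/-- The product `x_a x_{a+1} x_a ⋯` with `k` factors; it begins with `x_a`. -/
def alt (a : ZMod 2) : ℕ → A
  | 0 => 1
  | k + 1 => x a * alt (a + 1) k

/-- The product `⋯ x_a x_{a+1} x_a` with `k` factors; it ends with `x_a`. -/
def altr (a : ZMod 2) : ℕ → A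
  | 0 => 1
  | k + 1 => altr (a + 1) k * x a

lemma alt_succ (a : ZMod 2) (k : ℕ) : alt x a (k + 1) = x a * alt x (a + 1) k := rfl

lemma altr_succ (a : ZMod 2) (k : ℕ) : altr x a (k + 1) = altr x (a + 1) k * x a := rfl

lemma alt_add (a : ZMod 2) (k l : ℕ) : alt x a (k + l) = alt x a k * alt x (a + k) l := by
  induction k generalizing a with
  | zero => simp [alt]
  | succ k ih =>
    rw [Nat.add_right_comm, alt, alt, ih, mul_assoc]
    rw [show a + 1 + (k : ZMod 2) = a + (k + 1 : ℕ) by push_cast; ring]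

lemma altr_add (a : ZMod 2) (k l : ℕ) : altr x a (k + l) = altr x (a + l) k * altr x a l := by
  induction l generalizing a with
  | zero => simp [altr]
  | succ l ih =>
    rw [← add_assoc, altr, altr, ih, mul_assoc]
    rw [show a + 1 + (l : ZMod 2) = a + (l + 1 : ℕ) by push_cast; ring]

lemma alt_succ' (a : ZMod 2) (k : ℕ) : alt x a (k + 1) = alt x a k * x (a + k) := by
  rw [alt_add, alt, alt, mul_one]

lemma altr_succ' (a : ZMod 2) (k : ℕ) : altr x a (k + 1) = x (a + k) * altr x a k := by
  rw [add_comm, altr_add, altr, altr, one_mul]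

lemma altr_eq_alt (a : ZMod 2) (k : ℕ) : altr x a k = alt x (a + 1 + k) k := by
  induction k generalizing a with
  | zero => rfl
  | succ k ih =>
    rw [altr, ih, alt_succ']
    push_cast
    congr 2
    · ring
    · linear_combination (-(k : ZMod 2) - 1) * zmod_two_two

end Alternating

/-! ### Products of length `m` in two pairs of letters -/

/-- The relations between the letters `x_a, e_a` (`a = 0, 1`) attached to a pair of generators with
`m_{ij} = m ≥ 3`; the two generators are indexed by `ℤ/2`, so that `a + m` is the index of the
reflection into which the longest element of the dihedral group conjugates the reflection `a`. Only
the shape of the relations matters, so that the structure constants are existentially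
quantified. -/
structure DihedralRelations (K : Type*) {R : Type*} [Field K] [Ring R] [Algebra K R]
    (x : ZMod 2 → Rˣ) (e : ZMod 2 → R) (m : ℕ) : Prop where
  three_le : 3 ≤ m
  inv_eq : ∀ a, ∃ r s : K, (↑(x a)⁻¹ : R) = x a + r • (1 : R) + s • e a
  sq_eq : ∀ a, ∃ r s : K, (x a * x a : R) = 1 + r • (x a : R) + s • e a
  e_eq : ∀ a, ∃ r s u : K, e a = r • (x a * x a : R) + s • (x a : R) + u • 1
  x_mul_e : ∀ a, ∃ c : K, x a * e a = c • e a
  e_mul_x : ∀ a, ∃ c : K, e a * x a = c • e a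
  braid : alt x 0 m = alt x 1 m
  twist : ∀ a, e a * (alt x (a + 1) (m - 1) : Rˣ) = (alt x (a + 1) (m - 1) : Rˣ) * e (a + m)
  sandwich : ∀ a, ∀ b ∈ Algebra.adjoin K (Set.range (fun a ↦ (x a : R)) ∪ Set.range e),
    ∃ c : K, e a * b * e a = c • e a
  mixed : Even m → ∀ a, ∀ b ∈ Algebra.adjoin K (Set.range (fun a ↦ (x a : R)) ∪ Set.range e),
    e a * b * e (a + 1) = 0

namespace DihedralRelations

variable (K : Type*) {R : Type*} [Field K] [Ring R] [Algebra K R] (x : ZMod 2 → Rˣ) (e : ZMod 2 → R)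

/-- The subalgebra generated by the letters, as a subspace. -/
def gen : Submodule K R :=
  (Algebra.adjoin K (Set.range (fun a ↦ (x a : R)) ∪ Set.range e)).toSubmodule

/-- The span of the two letters with index `a`. -/
def pair (a : ZMod 2) : Submodule K R := Submodule.span K {(x a : R), e a}

/-- The span of `1` and the letters. Its `k`-th power is the span of the words of length at
most `k`. -/
def letters : Submodule K R := 1 ⊔ (pair K x e 0 ⊔ pair K x e 1)

/-- The left ideal `∑_a B e_a L_t`, where `B` is the algebra generated by the letters and `L_t` is
the span of the words of length less than `t`. -/
def leftIdeal : ℕ → Submodule K R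
  | 0 => ⊥
  | t + 1 => ⨆ a, gen K x e * Submodule.span K {e a} * letters K x e ^ t

variable {K x e}

lemma x_mem_pair (a : ZMod 2) : (x a : R) ∈ pair K x e a := Submodule.subset_span (by simp)

lemma e_mem_pair (a : ZMod 2) : e a ∈ pair K x e a := Submodule.subset_span (by simp)

lemma pair_le_letters (a : ZMod 2) : pair K x e a ≤ letters K x e := by
  rcases zmod_two_eq_or a 0 with rfl | rfl
  · exact le_sup_left.trans le_sup_right
  · exact le_sup_right.trans le_sup_right

lemma one_le_letters : 1 ≤ letters K x e := le_sup_left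

lemma one_mem_letters : 1 ∈ letters K x e := one_le_letters ((Submodule.one_le.1 le_rfl))

lemma x_mem_letters (a : ZMod 2) : (x a : R) ∈ letters K x e := pair_le_letters a (x_mem_pair a)

lemma e_mem_letters (a : ZMod 2) : e a ∈ letters K x e := pair_le_letters a (e_mem_pair a)

lemma letters_pow_mono {k l : ℕ} (h : k ≤ l) : letters K x e ^ k ≤ letters K x e ^ l :=
  pow_le_pow_right' one_le_letters h

lemma x_mem_gen (a : ZMod 2) : (x a : R) ∈ gen K x e :=
  Algebra.subset_adjoin (Or.inl ⟨a, rfl⟩)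

lemma e_mem_gen (a : ZMod 2) : e a ∈ gen K x e :=
  Algebra.subset_adjoin (Or.inr ⟨a, rfl⟩)

lemma one_mem_gen : (1 : R) ∈ gen K x e := one_mem (Algebra.adjoin K _)

lemma mul_mem_gen {y z : R} (hy : y ∈ gen K x e) (hz : z ∈ gen K x e) : y * z ∈ gen K x e :=
  mul_mem (S := Subalgebra K R) hy hz

lemma gen_mul_gen : gen K x e * gen K x e ≤ gen K x e :=
  Submodule.mul_le.2 fun _ hy _ hz ↦ mul_mem_gen hy hz

lemma letters_le_gen : letters K x e ≤ gen K x e := by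
  refine sup_le (Submodule.one_le.2 one_mem_gen) (sup_le ?_ ?_) <;>
  · refine Submodule.span_le.2 ?_
    rintro _ (rfl | rfl)
    exacts [x_mem_gen _, e_mem_gen _]

lemma letters_pow_le_gen (k : ℕ) : letters K x e ^ k ≤ gen K x e := by
  induction k with
  | zero => exact Submodule.one_le.2 one_mem_gen
  | succ k ih => exact (pow_succ _ k).trans_le ((mul_le_mul' ih letters_le_gen).trans gen_mul_gen)

/-- It suffices to check on the letters that right multiplication of `y` by `letters` ends
in `T`. -/
lemma span_mul_letters_le {T : Submodule K R} {y : R} (h1 : y ∈ T) (hx : ∀ a, y * x a ∈ T)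
    (he : ∀ a, y * e a ∈ T) : Submodule.span K {y} * letters K x e ≤ T := by
  have hp (a : ZMod 2) : Submodule.span K {y} * pair K x e a ≤ T := by
    rw [pair, Submodule.span_mul_span, Submodule.span_le]
    rintro _ ⟨_, rfl, _, rfl | rfl, rfl⟩
    exacts [hx a, he a]
  rw [letters, Submodule.mul_sup, Submodule.mul_sup, mul_one]
  exact sup_le (by simpa using h1) (sup_le (hp 0) (hp 1))

lemma coe_alt_mem (a : ZMod 2) (k : ℕ) : ((alt x a k : Rˣ) : R) ∈ alt (pair K x e) a k := by
  induction k generalizing a with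
  | zero => exact (Submodule.one_le.1 le_rfl)
  | succ k ih => exact Submodule.mul_mem_mul (x_mem_pair a) (ih _)

lemma coe_altr_mem (a : ZMod 2) (k : ℕ) : ((altr x a k : Rˣ) : R) ∈ altr (pair K x e) a k := by
  induction k generalizing a with
  | zero => exact (Submodule.one_le.1 le_rfl)
  | succ k ih => exact Submodule.mul_mem_mul (ih _) (x_mem_pair a)

lemma alt_pair_le (a : ZMod 2) (k : ℕ) : alt (pair K x e) a k ≤ letters K x e ^ k := by
  induction k generalizing a with
  | zero => exact le_rfl
  | succ k ih => exact (mul_le_mul' (pair_le_letters a) (ih _)).trans (pow_succ' _ k).ge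

lemma coe_alt_mem_letters (a : ZMod 2) (k : ℕ) : ((alt x a k : Rˣ) : R) ∈ letters K x e ^ k :=
  alt_pair_le a k (coe_alt_mem a k)

lemma coe_altr_mem_letters (a : ZMod 2) (k : ℕ) :
    ((altr x a k : Rˣ) : R) ∈ letters K x e ^ k := by
  rw [altr_eq_alt]
  exact coe_alt_mem_letters _ k

lemma mul_mem_pow_add {y z : R} {k l : ℕ} (hy : y ∈ letters K x e ^ k)
    (hz : z ∈ letters K x e ^ l) : y * z ∈ letters K x e ^ (k + l) := by
  rw [pow_add]
  exact Submodule.mul_mem_mul hy hz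

lemma mem_leftIdeal {b v : R} {t : ℕ} (a : ZMod 2) (hb : b ∈ gen K x e)
    (hv : v ∈ letters K x e ^ t) : b * e a * v ∈ leftIdeal K x e (t + 1) :=
  Submodule.mem_iSup_of_mem a
    (Submodule.mul_mem_mul (Submodule.mul_mem_mul hb (Submodule.mem_span_singleton_self (e a))) hv)

lemma leftIdeal_mono : Monotone (leftIdeal K x e) := by
  refine monotone_nat_of_le_succ fun t ↦ ?_
  cases t with
  | zero => exact bot_le
  | succ t => exact iSup_mono fun a ↦ mul_le_mul' le_rfl (letters_pow_mono t.le_succ)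

lemma gen_mul_leftIdeal (t : ℕ) : gen K x e * leftIdeal K x e t ≤ leftIdeal K x e t := by
  cases t with
  | zero => simp [leftIdeal]
  | succ t =>
    rw [leftIdeal, Submodule.mul_iSup]
    refine iSup_mono fun a ↦ ?_
    rw [← mul_assoc, ← mul_assoc]
    gcongr
    exact gen_mul_gen

lemma leftIdeal_mul_letters (t : ℕ) :
    leftIdeal K x e t * letters K x e ≤ leftIdeal K x e (t + 1) := by
  cases t with
  | zero => simp [leftIdeal]
  | succ t =>
    rw [leftIdeal, leftIdeal, Submodule.iSup_mul]
    refine iSup_mono fun a ↦ ?_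
    rw [mul_assoc _ _ (letters K x e), ← pow_succ]

lemma mul_mem_leftIdeal {b z : R} {t : ℕ} (hb : b ∈ gen K x e) (hz : z ∈ leftIdeal K x e t) :
    b * z ∈ leftIdeal K x e t := gen_mul_leftIdeal t (Submodule.mul_mem_mul hb hz)

lemma mem_leftIdeal_of_gen_mul_e {b : R} (t : ℕ) (a : ZMod 2) (hb : b ∈ gen K x e) :
    b * e a ∈ leftIdeal K x e (t + 1) := by
  refine leftIdeal_mono (Nat.succ_le_succ t.zero_le) ?_
  simpa using mem_leftIdeal (t := 0) a hb (Submodule.one_le.1 le_rfl)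

variable {m : ℕ}

lemma inv_mem_letters (h : DihedralRelations K x e m) (a : ZMod 2) :
    (↑(x a)⁻¹ : R) ∈ letters K x e := by
  obtain ⟨r, s, hrs⟩ := h.inv_eq a
  rw [hrs]
  exact add_mem (add_mem (x_mem_letters a) (Submodule.smul_mem _ _ one_mem_letters))
    (Submodule.smul_mem _ _ (e_mem_letters a))

lemma altr_inv_mem_letters (h : DihedralRelations K x e m) (a : ZMod 2) (k : ℕ) :
    (↑(altr x a k)⁻¹ : R) ∈ letters K x e ^ k := by
  induction k generalizing a with
  | zero =>
    rw [altr, inv_one, Units.val_one, pow_zero]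
    exact Submodule.one_le.1 le_rfl
  | succ k ih =>
    rw [altr_succ, mul_inv_rev, Units.val_mul, pow_succ']
    exact Submodule.mul_mem_mul (h.inv_mem_letters a) (ih _)

lemma alt_inv_mem_letters (h : DihedralRelations K x e m) (a : ZMod 2) (k : ℕ) :
    (↑(alt x a k)⁻¹ : R) ∈ letters K x e ^ k := by
  have := h.altr_inv_mem_letters (a + 1 + k) k
  rwa [altr_eq_alt, show a + 1 + k + 1 + k = a by
    linear_combination ((k : ZMod 2) + 1) * zmod_two_two] at this

lemma alt_eq_alt (h : DihedralRelations K x e m) (a b : ZMod 2) : alt x a m = alt x b m := by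
  have key (a : ZMod 2) : alt x a m = alt x 0 m := by
    rcases zmod_two_eq_or a 0 with rfl | rfl
    · rfl
    · exact h.braid.symm
  rw [key a, key b]

lemma cast_pred (h : DihedralRelations K x e m) : ((m - 1 : ℕ) : ZMod 2) = m + 1 := by
  have h3 := h.three_le
  rw [Nat.cast_sub (by omega)]
  linear_combination -zmod_two_two

/-- The relation `twist`, with the conjugating element written as `altr`. -/
lemma altr_mul_e (h : DihedralRelations K x e m) (a : ZMod 2) :
    (altr x (a + 1) (m - 1) : Rˣ) * e a = e (a + m) * (altr x (a + 1) (m - 1) : Rˣ) := by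
  have h1 := h.twist (a + m)
  rw [altr_eq_alt, h.cast_pred, show a + 1 + 1 + (m + 1 : ZMod 2) = a + m + 1 by
    linear_combination zmod_two_two, h1, show a + m + m = a by
    linear_combination (m : ZMod 2) * zmod_two_two]

/-- The products `e_b y e_a` are multiples of the products `⋯ x_a x_{a+1} e_a`: for `b = a` with no
factor `x`, and for `b ≠ a` with `m - 1` factors, the product being zero if `m` is even. -/
lemma e_mul_mul_e (h : DihedralRelations K x e m) (a b : ZMod 2) {y : R} (hy : y ∈ gen K x e) :
    ∃ s < m, ∃ c : K, e b * y * e a = c • ((altr x (a + 1) s : Rˣ) * e a) := by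
  have h3 := h.three_le
  rcases zmod_two_eq_or b a with rfl | rfl
  · obtain ⟨c, hc⟩ := h.sandwich b y hy
    exact ⟨0, by omega, c, by simp [hc, altr]⟩
  refine ⟨m - 1, by omega, ?_⟩
  rcases Nat.even_or_odd m with hm | hm
  · have := h.mixed hm (a + 1) y hy
    rw [show a + 1 + 1 = a by linear_combination zmod_two_two] at this
    exact ⟨0, by rw [this, zero_smul]⟩
  · -- `e_{a+1}` is the conjugate of `e_a` by the alternating product `D`
    have hm1 : (m : ZMod 2) = 1 := (ZMod.natCast_eq_one_iff_odd).2 hm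
    have h1 := h.altr_mul_e a
    rw [hm1] at h1
    set D := altr x (a + 1) (m - 1)
    have h2 : e (a + 1) = D * e a * (↑D⁻¹ : R) := by rw [h1, Units.mul_inv_cancel_right]
    obtain ⟨c, hc⟩ := h.sandwich a (↑D⁻¹ * y)
      (mul_mem_gen (letters_pow_le_gen _ (h.altr_inv_mem_letters _ _)) hy)
    refine ⟨c, ?_⟩
    rw [h2, ← mul_smul_comm, ← hc]
    simp only [mul_assoc]

/-- The left ideal generated by `e_a` is spanned by the products `⋯ x_a x_{a+1} e_a` with fewer than
`m` factors `x`. -/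
lemma mul_e_mem_span (h : DihedralRelations K x e m) (a : ZMod 2) {b : R} (hb : b ∈ gen K x e) :
    b * e a ∈ Submodule.span K {z | ∃ s < m, z = (altr x (a + 1) s : Rˣ) * e a} := by
  have h3 := h.three_le
  set N := Submodule.span K {z | ∃ s < m, z = ((altr x (a + 1) s : Rˣ) : R) * e a}
  have hN (s : ℕ) (hs : s < m) : ((altr x (a + 1) s : Rˣ) : R) * e a ∈ N :=
    Submodule.subset_span ⟨s, hs, rfl⟩
  have hx (d : ZMod 2) : ∀ z ∈ N, x d * z ∈ N := by
    suffices N ≤ N.comap (LinearMap.mulLeft K (x d : R)) from this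
    refine Submodule.span_le.2 ?_
    rintro _ ⟨s, hs, rfl⟩
    change (x d : R) * _ ∈ N
    rcases zmod_two_eq_or d (a + 1 + s) with rfl | rfl
    · rw [← mul_assoc, ← Units.val_mul, ← altr_succ']
      rcases Nat.lt_or_ge (s + 1) m with hsm | hsm
      · exact hN _ hsm
      · obtain ⟨c, hc⟩ := h.x_mul_e a
        have hm : s + 1 = m := by omega
        have h1 : altr x (a + 1) (s + 1) = altr x (a + 1) s * x a := by
          rw [← altr_succ, altr_eq_alt, altr_eq_alt, hm]
          exact h.alt_eq_alt _ _
        rw [h1, Units.val_mul, mul_assoc, hc, mul_smul_comm]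
        exact Submodule.smul_mem _ _ (hN s hs)
    · cases s with
      | zero =>
        obtain ⟨c, hc⟩ := h.x_mul_e a
        rw [show a + 1 + ((0 : ℕ) : ZMod 2) + 1 = a by
          push_cast; linear_combination zmod_two_two]
        simp only [altr, Units.val_one, one_mul, hc]
        simpa [altr] using Submodule.smul_mem _ c (hN 0 (by omega))
      | succ s =>
        rw [show a + 1 + ((s + 1 : ℕ) : ZMod 2) + 1 = a + 1 + s by
          push_cast; linear_combination zmod_two_two]
        obtain ⟨r, u, hru⟩ := h.sq_eq (a + 1 + s)
        obtain ⟨s', hs', c, hc⟩ := h.e_mul_mul_e a (a + 1 + s)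
          (letters_pow_le_gen _ (coe_altr_mem_letters (K := K) (x := x) (e := e) (a + 1) s))
        have h1 := hN (s + 1) hs
        rw [altr_succ', Units.val_mul] at h1 ⊢
        rw [← mul_assoc, ← mul_assoc, hru, add_mul, add_mul, add_mul, add_mul, one_mul,
          smul_mul_assoc, smul_mul_assoc, smul_mul_assoc, smul_mul_assoc, hc]
        exact add_mem (add_mem (hN s (by omega)) (Submodule.smul_mem _ _ h1))
          (Submodule.smul_mem _ _ (Submodule.smul_mem _ _ (hN s' hs')))
  have hgen : ∀ z ∈ N, b * z ∈ N := by
    refine Algebra.adjoin_induction (p := fun b _ ↦ ∀ z ∈ N, b * z ∈ N) ?_ ?_ ?_ ?_ hb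
    · rintro _ (⟨d, rfl⟩ | ⟨d, rfl⟩) z hz
      · exact hx d z hz
      · obtain ⟨r, s, u, hrsu⟩ := h.e_eq d
        rw [hrsu, add_mul, add_mul, smul_mul_assoc, smul_mul_assoc, smul_mul_assoc, one_mul,
          mul_assoc]
        exact add_mem (add_mem (Submodule.smul_mem _ _ (hx d _ (hx d z hz)))
          (Submodule.smul_mem _ _ (hx d z hz))) (Submodule.smul_mem _ _ hz)
    · intro r z hz
      rw [← Algebra.smul_def]
      exact Submodule.smul_mem _ _ hz
    · intro b c _ _ hb hc z hz
      rw [add_mul]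
      exact add_mem (hb z hz) (hc z hz)
    · intro b c _ _ hb hc z hz
      rw [mul_assoc]
      exact hb _ (hc z hz)
  exact hgen _ (by simpa [altr] using hN 0 (by omega))

/-- A word of length `t` after `e_a` may be assumed to be alternating in the `x`. -/
lemma span_e_mul_pow_le (h : DihedralRelations K x e m) (a : ZMod 2) (t : ℕ) :
    Submodule.span K {e a} * letters K x e ^ t ≤
      Submodule.span K {e a * (alt x (a + 1) t : Rˣ)} ⊔ leftIdeal K x e t := by
  induction t with
  | zero => simp [alt]
  | succ t ih =>
    rw [pow_succ, ← mul_assoc]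
    refine (mul_le_mul' ih le_rfl).trans ?_
    rw [Submodule.sup_mul]
    refine sup_le ?_ ((leftIdeal_mul_letters t).trans le_sup_right)
    have hle {z : R} (hz : z ∈ leftIdeal K x e (t + 1)) :
        z ∈ Submodule.span K {e a * ((alt x (a + 1) (t + 1) : Rˣ) : R)} ⊔
          leftIdeal K x e (t + 1) := Submodule.mem_sup_right hz
    have hmem {v : R} (hv : v ∈ letters K x e ^ t) : e a * v ∈ leftIdeal K x e (t + 1) := by
      simpa using mem_leftIdeal a one_mem_gen hv
    have he {v : R} (d : ZMod 2) (hv : v ∈ letters K x e ^ t) :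
        e a * v * e d ∈ leftIdeal K x e (t + 1) :=
      mem_leftIdeal_of_gen_mul_e t d (mul_mem_gen (e_mem_gen a) (letters_pow_le_gen t hv))
    refine span_mul_letters_le (hle (hmem (coe_alt_mem_letters _ t))) (fun d ↦ ?_)
      (fun d ↦ hle (he d (coe_alt_mem_letters _ t)))
    rcases zmod_two_eq_or d (a + 1 + t) with rfl | rfl
    · rw [mul_assoc, ← Units.val_mul, ← alt_succ']
      exact Submodule.mem_sup_left (Submodule.mem_span_singleton_self _)
    · apply hle
      cases t with
      | zero =>
        obtain ⟨c, hc⟩ := h.e_mul_x a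
        rw [show a + 1 + ((0 : ℕ) : ZMod 2) + 1 = a by
          push_cast; linear_combination zmod_two_two]
        simp only [alt, Units.val_one, mul_one, hc]
        exact Submodule.smul_mem _ _ (by simpa using hmem (Submodule.one_le.1 le_rfl))
      | succ t =>
        rw [show a + 1 + ((t + 1 : ℕ) : ZMod 2) + 1 = a + 1 + t by
          push_cast; linear_combination zmod_two_two]
        obtain ⟨r, u, hru⟩ := h.sq_eq (a + 1 + t)
        have h1 := hmem (coe_alt_mem_letters (a + 1) (t + 1))
        have h2 := letters_pow_mono t.le_succ (coe_alt_mem_letters (K := K) (e := e) (x := x)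
          (a + 1) t)
        rw [alt_succ', Units.val_mul] at h1 ⊢
        rw [mul_assoc, mul_assoc, hru]
        simp only [mul_add, mul_one, mul_smul_comm]
        rw [← mul_assoc (e a) _ (e (a + 1 + t))]
        exact add_mem (add_mem (hmem h2) (Submodule.smul_mem _ _ h1))
          (Submodule.smul_mem _ _ (he _ h2))

/-- Modulo `leftIdeal t`, the factors of an alternating product after `e_a` may be replaced by their
inverses. -/
lemma e_mul_alt_sub_mem (h : DihedralRelations K x e m) (a : ZMod 2) (t : ℕ) :
    e a * (alt x (a + 1) t : Rˣ) - e a * (↑(altr x (a + 1) t)⁻¹ : R) ∈ leftIdeal K x e t := by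
  induction t with
  | zero => simp [alt, altr]
  | succ t ih =>
    rw [alt_succ', altr_succ', mul_inv_rev, Units.val_mul, Units.val_mul]
    set d : ZMod 2 := a + 1 + t
    obtain ⟨r, s, hrs⟩ := h.inv_eq d
    set u := altr x (a + 1) t
    have hu : (↑u⁻¹ : R) ∈ letters K x e ^ t := h.altr_inv_mem_letters _ _
    have h1 : e a * (alt x (a + 1) t * x d) - e a * (↑u⁻¹ * (↑(x d)⁻¹ : R)) =
        (e a * (alt x (a + 1) t : Rˣ) - e a * (↑u⁻¹ : R)) * x d
          - (r • (1 * e a * ↑u⁻¹) + s • (e a * ↑u⁻¹ * e d)) := by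
      rw [hrs, sub_mul, mul_add, mul_add, mul_add, mul_add, mul_smul_comm, mul_smul_comm,
        mul_smul_comm, mul_smul_comm, mul_one, one_mul]
      simp only [mul_assoc]
      abel
    rw [h1]
    refine sub_mem (leftIdeal_mul_letters t (Submodule.mul_mem_mul ih (x_mem_letters d)))
      (add_mem (Submodule.smul_mem _ _ (mem_leftIdeal a one_mem_gen hu))
        (Submodule.smul_mem _ _ (mem_leftIdeal_of_gen_mul_e t d
          (mul_mem_gen (e_mem_gen a) (letters_pow_le_gen t hu)))))

/-- The left ideals `leftIdeal t` are stationary from `t = m / 2` on: a long alternating product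
after `e_a` can be moved, up to a shorter remainder, to the left of the letter. -/
lemma leftIdeal_succ_le (h : DihedralRelations K x e m) {t : ℕ} (ht : m ≤ 2 * t) :
    leftIdeal K x e (t + 1) ≤ leftIdeal K x e t := by
  have h3 := h.three_le
  have key (a : ZMod 2) : e a * (alt x (a + 1) t : Rˣ) ∈ leftIdeal K x e t := by
    have hD : ((alt x (a + 1) (m - 1) : Rˣ) : R) ∈ gen K x e :=
      letters_pow_le_gen _ (coe_alt_mem_letters _ _)
    rcases le_total t (m - 1) with hle | hle
    · obtain ⟨r, hr⟩ := Nat.exists_eq_add_of_le hle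
      have h1 : alt x (a + 1) t = alt x (a + 1) (m - 1) * (alt x (a + 1 + t) r)⁻¹ := by
        rw [hr, alt_add, mul_inv_cancel_right]
      rw [h1, Units.val_mul, ← mul_assoc, h.twist]
      exact leftIdeal_mono (by omega) (mem_leftIdeal (a + m) hD (h.alt_inv_mem_letters _ r))
    · obtain ⟨r, hr⟩ := Nat.exists_eq_add_of_le hle
      rw [hr, alt_add, Units.val_mul, ← mul_assoc, h.twist, ← hr]
      exact leftIdeal_mono (by omega) (mem_leftIdeal (a + m) hD (coe_alt_mem_letters _ r))
  refine iSup_le fun a ↦ ?_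
  rw [mul_assoc]
  refine (mul_le_mul' le_rfl (h.span_e_mul_pow_le a t)).trans ?_
  rw [Submodule.mul_sup]
  refine sup_le ?_ (gen_mul_leftIdeal t)
  refine (mul_le_mul' le_rfl ?_).trans (gen_mul_leftIdeal t)
  rw [Submodule.span_singleton_le_iff_mem]
  exact key a

/-- The inverse of an alternating product is, modulo shorter words, a combination of alternating
products of the letters. -/
lemma altr_inv_mem_sup (h : DihedralRelations K x e m) (b : ZMod 2) (t : ℕ) :
    (↑(altr x b (t + 1))⁻¹ : R) ∈ alt (pair K x e) b (t + 1) ⊔ letters K x e ^ t := by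
  have hinv (b : ZMod 2) : (↑(x b)⁻¹ : R) ∈ pair K x e b ⊔ 1 := by
    obtain ⟨r, s, hrs⟩ := h.inv_eq b
    rw [hrs, add_right_comm]
    exact Submodule.add_mem_sup (add_mem (x_mem_pair b) (Submodule.smul_mem _ _ (e_mem_pair b)))
      (Submodule.smul_mem _ _ (Submodule.one_le.1 le_rfl))
  induction t generalizing b with
  | zero => simpa [altr, alt] using hinv b
  | succ t ih =>
    rw [altr_succ, mul_inv_rev, Units.val_mul]
    refine (?_ : (pair K x e b ⊔ 1) * (alt (pair K x e) (b + 1) (t + 1) ⊔ letters K x e ^ t) ≤ _)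
      (Submodule.mul_mem_mul (hinv b) (ih (b + 1)))
    rw [Submodule.sup_mul, Submodule.mul_sup, one_mul]
    refine sup_le (sup_le le_sup_left ?_) (sup_le ?_ ?_)
    · exact (mul_le_mul' (pair_le_letters b) le_rfl).trans ((pow_succ' _ t).ge.trans le_sup_right)
    · exact (alt_pair_le _ _).trans le_sup_right
    · exact (letters_pow_mono t.le_succ).trans le_sup_right

/-- The inductive step for a product `u e_a v` with alternating products `u` and `v`, of lengths `s`
and `t`, where `v` is the shorter side (`2t < m`). If the product is neither short nor an alternating
word beginning with the index `c`, then it is moved across the alternating product of length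
`m - 1`. -/
lemma altr_mul_e_mul_alt_mem (h : DihedralRelations K x e m) (c a : ZMod 2) {s t : ℕ} (hs : s < m)
    (ht : 2 * t + 1 ≤ m)
    (hle : leftIdeal K x e t ≤ letters K x e ^ (m - 1) ⊔ alt (pair K x e) c m) :
    (altr x (a + 1) s : Rˣ) * e a * (alt x (a + 1) t : Rˣ) ∈
      letters K x e ^ (m - 1) ⊔ alt (pair K x e) c m := by
  have h3 := h.three_le
  rcases Nat.lt_or_ge (s + 1 + t) m with hlt | hge
  · refine Submodule.mem_sup_left (letters_pow_mono (k := s + 1 + t) (by omega) ?_)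
    exact mul_mem_pow_add (mul_mem_pow_add (coe_altr_mem_letters _ _)
      (by simpa using e_mem_letters a)) (coe_alt_mem_letters _ _)
  by_cases hc : s + 1 + t = m ∧ c = a + s
  · -- the product is an alternating word beginning with the index `c`
    obtain ⟨hst, rfl⟩ := hc
    refine Submodule.mem_sup_right ?_
    have h1 : alt (pair K x e) (a + s) m =
        altr (pair K x e) (a + 1) s * pair K x e a * alt (pair K x e) (a + 1) t := by
      rw [← hst, alt_add, ← altr_succ, altr_eq_alt]
      push_cast
      congr 2
      · linear_combination -zmod_two_two
      · linear_combination (s : ZMod 2) * zmod_two_two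
    rw [h1]
    exact Submodule.mul_mem_mul (Submodule.mul_mem_mul (coe_altr_mem _ _) (e_mem_pair a))
      (coe_alt_mem _ _)
  -- otherwise the product is moved to the other side of the dihedral group
  obtain ⟨r, hr⟩ := Nat.exists_eq_add_of_le (show s ≤ m - 1 by omega)
  obtain ⟨u, hu⟩ := Nat.exists_eq_add_of_le (show t ≤ m - 1 by omega)
  set Y := altr x (a + 1 + s) r
  have hY : altr x (a + 1) s = Y⁻¹ * altr x (a + 1) (m - 1) := by
    rw [hr, add_comm s r, altr_add, inv_mul_cancel_left]
  have hmain : ((altr x (a + 1) s : Rˣ) : R) * e a * (↑(altr x (a + 1) t)⁻¹ : R) =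
      ↑Y⁻¹ * e (a + m) * (alt x (a + m + 1) u : Rˣ) := by
    have h1 : altr x (a + 1) (m - 1) = alt x (a + m + 1) u * altr x (a + 1) t := by
      have hu' := h.cast_pred
      rw [hu] at hu'
      push_cast at hu'
      rw [hu, add_comm t u, altr_add, altr_eq_alt x (a + 1 + t)]
      congr 2
      linear_combination hu' + zmod_two_two
    rw [hY, Units.val_mul, mul_assoc _ _ (e a), h.altr_mul_e, h1, Units.val_mul]
    simp only [mul_assoc, Units.mul_inv, mul_one]
  have hsub := hle (mul_mem_leftIdeal (letters_pow_le_gen s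
    (coe_altr_mem_letters (a + 1) s)) (h.e_mul_alt_sub_mem a t))
  rw [mul_sub, ← mul_assoc, ← mul_assoc, hmain] at hsub
  refine (Submodule.sub_mem_iff_left _ ?_).1 hsub
  by_cases hst : s + 1 + t = m
  · obtain rfl : r = t := by omega
    have hc' : c = a + 1 + s := by
      rcases zmod_two_eq_or c (a + s) with hc' | hc'
      · exact absurd ⟨hst, hc'⟩ hc
      · rw [hc']
        ring
    have hm : (m : ZMod 2) = s + 1 + r := by rw [← hst]; push_cast; ring
    have h1 : alt (pair K x e) c m =
        alt (pair K x e) c r * pair K x e (a + m) * alt (pair K x e) (a + m + 1) u := by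
      rw [show m = r + (u + 1) by omega, alt_add, alt_succ, mul_assoc, ← show m = r + (u + 1) by
        omega, show c + r = a + m by rw [hc', hm]; ring]
    have htail : e (a + m) * (alt x (a + m + 1) u : Rˣ) ∈
        pair K x e (a + m) * alt (pair K x e) (a + m + 1) u :=
      Submodule.mul_mem_mul (e_mem_pair _) (coe_alt_mem _ _)
    rw [mul_assoc]
    cases r with
    | zero =>
      refine Submodule.mem_sup_right ?_
      rw [h1]
      simpa [Y, altr, alt] using htail
    | succ r =>
      have hYinv : (↑Y⁻¹ : R) ∈ _ := h.altr_inv_mem_sup (a + 1 + s) r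
      have h2 := Submodule.mul_mem_mul hYinv htail
      rw [Submodule.sup_mul, ← mul_assoc (alt _ _ _), ← hc', ← h1, sup_comm] at h2
      have hshort : letters K x e ^ r * (pair K x e (a + m) * alt (pair K x e) (a + m + 1) u) ≤
          letters K x e ^ (m - 1) := by
        refine (mul_le_mul' le_rfl (mul_le_mul' (pair_le_letters _) (alt_pair_le _ _))).trans ?_
        rw [← pow_succ', ← pow_add]
        exact letters_pow_mono (by omega)
      have hsup := sup_le_sup_right hshort (alt (pair K x e) c m)
      exact hsup h2
  · refine Submodule.mem_sup_left (letters_pow_mono (k := r + 1 + u) (by omega) ?_)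
    exact mul_mem_pow_add (mul_mem_pow_add (h.altr_inv_mem_letters _ _)
      (by simpa using e_mem_letters _)) (coe_alt_mem_letters _ _)

/-- Every product containing a letter `e_a` is a combination of words of length less than `m` and of
alternating words of length `m` with a prescribed first index. -/
lemma leftIdeal_le (h : DihedralRelations K x e m) (c : ZMod 2) (t : ℕ) :
    leftIdeal K x e t ≤ letters K x e ^ (m - 1) ⊔ alt (pair K x e) c m := by
  induction t with
  | zero => exact bot_le
  | succ t ih =>
    rcases Nat.lt_or_ge (2 * t) m with ht | ht
    · refine iSup_le fun a ↦ ?_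
      rw [mul_assoc]
      refine (mul_le_mul' le_rfl (h.span_e_mul_pow_le a t)).trans ?_
      rw [Submodule.mul_sup]
      refine sup_le ?_ ((gen_mul_leftIdeal t).trans ih)
      rw [Submodule.mul_le]
      intro b hb z hz
      obtain ⟨k, rfl⟩ := Submodule.mem_span_singleton.1 hz
      rw [mul_smul_comm, ← mul_assoc]
      refine Submodule.smul_mem _ _ ?_
      suffices Submodule.span K {z | ∃ s < m, z = (altr x (a + 1) s : Rˣ) * e a} ≤
          (letters K x e ^ (m - 1) ⊔ alt (pair K x e) c m).comap
            (LinearMap.mulRight K ((alt x (a + 1) t : Rˣ) : R)) from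
        this (h.mul_e_mem_span a hb)
      refine Submodule.span_le.2 ?_
      rintro _ ⟨s, hs, rfl⟩
      exact h.altr_mul_e_mul_alt_mem c a hs ht ih
    · exact (h.leftIdeal_succ_le ht).trans ih

lemma alt_pair_le_sup (a : ZMod 2) (k : ℕ) :
    alt (pair K x e) a k ≤ Submodule.span K {((alt x a k : Rˣ) : R)} ⊔ leftIdeal K x e k := by
  induction k generalizing a with
  | zero => simp [alt, Submodule.one_eq_span]
  | succ k ih =>
    have hpair : pair K x e a = Submodule.span K {(x a : R)} ⊔ Submodule.span K {e a} := by
      rw [pair, Submodule.span_insert]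
    rw [alt_succ, alt_succ]
    nth_rw 1 [hpair]
    rw [Submodule.sup_mul]
    refine sup_le ((mul_le_mul' le_rfl (ih _)).trans ?_)
      ((mul_le_mul' le_rfl (alt_pair_le _ _)).trans ?_)
    · rw [Submodule.mul_sup, Submodule.span_mul_span, Set.singleton_mul_singleton, Units.val_mul]
      refine sup_le_sup_left ?_ _
      refine (mul_le_mul' ?_ le_rfl).trans ((gen_mul_leftIdeal k).trans (leftIdeal_mono k.le_succ))
      rw [Submodule.span_singleton_le_iff_mem]
      exact x_mem_gen a
    · refine le_sup_of_le_right (le_iSup_of_le a ?_)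
      refine mul_le_mul' ?_ le_rfl
      exact (one_mul _).ge.trans (mul_le_mul' (Submodule.one_le.2 one_mem_gen) le_rfl)

/-- Braid relations for words in the letters `x_a` and `e_a`: modulo shorter words, the first index
of an alternating word of length `m` can be chosen. -/
theorem alt_pair_le_alt_pair (h : DihedralRelations K x e m) (a b : ZMod 2) :
    alt (pair K x e) a m ≤ letters K x e ^ (m - 1) ⊔ alt (pair K x e) b m := by
  refine (alt_pair_le_sup a m).trans (sup_le ?_ (h.leftIdeal_le b m))
  rw [Submodule.span_singleton_le_iff_mem, h.alt_eq_alt a b]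
  exact Submodule.mem_sup_right (coe_alt_mem b m)

end DihedralRelations
end BMW

/-! ### The generators of `B_Γ(Π, κ)` -/

namespace BMW

open CoxeterMatrix Relation

section Quadratic

variable {K R : Type*} [Field K] [Ring R] [Algebra K R] {q l : K} {e : R}

/-- The quadratic relation `(q⁻¹ - q) e = l (x - q) (x + q⁻¹)`, solved for `x²`. -/
lemma mul_self_eq_of_smul_eq {x : R} (hl : l ≠ 0)
    (h : (q⁻¹ - q) • e = l • (x * x + (q⁻¹ - q) • x - 1)) :
    x * x = 1 + (q - q⁻¹) • x + (l⁻¹ * (q⁻¹ - q)) • e := by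
  rw [mul_smul, h, inv_smul_smul₀ hl]
  module

/-- The quadratic relation, solved for `e`. -/
lemma eq_of_smul_eq {x : R} (hq : q⁻¹ - q ≠ 0)
    (h : (q⁻¹ - q) • e = l • (x * x + (q⁻¹ - q) • x - 1)) :
    e = ((q⁻¹ - q)⁻¹ * l) • (x * x) + l • x + (-((q⁻¹ - q)⁻¹ * l)) • (1 : R) := by
  rw [← inv_smul_smul₀ hq e, h, smul_smul, smul_sub, smul_add, smul_smul, mul_right_comm,
    inv_mul_cancel₀ hq, one_mul]
  module

/-- The quadratic relation, solved for `x⁻¹`. -/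
lemma inv_eq_of_smul_eq {x : Rˣ} (hl : l ≠ 0)
    (h : (q⁻¹ - q) • e = l • ((x : R) * x + (q⁻¹ - q) • (x : R) - 1)) (hx : x * e = l⁻¹ • e) :
    (↑x⁻¹ : R) = x + (q⁻¹ - q) • (1 : R) + (q - q⁻¹) • e := by
  rw [← x.mul_right_inj, x.mul_inv, mul_add, mul_add, mul_self_eq_of_smul_eq hl h, mul_smul_comm,
    mul_smul_comm, hx, mul_one]
  module

end Quadratic

section Generators

variable {n : ℕ} (Γ : CoxeterMatrix (Fin n)) (P : Parameters Γ) (κ : ℂ)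

/-- The quotient map from the free algebra. -/
abbrev proj : FreeAlgebra ℂ (Gen n) →ₐ[ℂ] BMWAlgebra Γ P κ := RingQuot.mkAlgHom ℂ (Rel Γ P κ)

/-- The generator `X_i` as a unit of `B_Γ(Π, κ)`. -/
def genX (i : Fin n) : (BMWAlgebra Γ P κ)ˣ where
  val := proj Γ P κ (gX i)
  inv := proj Γ P κ (gXinv i)
  val_inv := by
    rw [← map_mul, RingQuot.mkAlgHom_rel ℂ (Rel.X_mul_Xinv i), map_one]
  inv_val := by
    rw [← map_mul, RingQuot.mkAlgHom_rel ℂ (Rel.Xinv_mul_X i), map_one]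

/-- The generator `E_i` of `B_Γ(Π, κ)`. -/
def genE (i : Fin n) : BMWAlgebra Γ P κ := proj Γ P κ (gE i)

/-- The span of `X_i` and `E_i`. -/
def genPair (i : Fin n) : Submodule ℂ (BMWAlgebra Γ P κ) :=
  Submodule.span ℂ {(genX Γ P κ i : BMWAlgebra Γ P κ), genE Γ P κ i}

/-- The span of `1` and all `X_i` and `E_i`. Its `k`-th power is the span of the words of length at
most `k`. -/
def genSpan : Submodule ℂ (BMWAlgebra Γ P κ) := 1 ⊔ ⨆ i, genPair Γ P κ i

/-- The span of the words of the form `Y_1 ⋯ Y_k`, where `ω = i_1 ⋯ i_k` and `Y_r` is `X_{i_r}` or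
`E_{i_r}`. -/
def wordSpan (ω : List (Fin n)) : Submodule ℂ (BMWAlgebra Γ P κ) := (ω.map (genPair Γ P κ)).prod

variable {Γ P κ}

lemma l_ne_zero (i : Fin n) : P.l κ i ≠ 0 :=
  div_ne_zero (Complex.exp_ne_zero _) (Complex.exp_ne_zero _)

lemma q_ne_zero (i : Fin n) : P.q κ i ≠ 0 := Complex.exp_ne_zero _

lemma genX_mul_genE (i : Fin n) :
    (genX Γ P κ i : BMWAlgebra Γ P κ) * genE Γ P κ i = (P.l κ i)⁻¹ • genE Γ P κ i := by
  rw [genE, ← map_smul, ← RingQuot.mkAlgHom_rel ℂ (Rel.X_mul_E i), map_mul]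
  rfl

lemma genE_mul_genX (i : Fin n) :
    genE Γ P κ i * (genX Γ P κ i : BMWAlgebra Γ P κ) = (P.l κ i)⁻¹ • genE Γ P κ i := by
  rw [genE, ← map_smul, ← RingQuot.mkAlgHom_rel ℂ (Rel.E_mul_X i), map_mul]
  rfl

lemma smul_genE (i : Fin n) :
    ((P.q κ i)⁻¹ - P.q κ i) • genE Γ P κ i =
      P.l κ i • ((genX Γ P κ i * genX Γ P κ i : BMWAlgebra Γ P κ) +
        ((P.q κ i)⁻¹ - P.q κ i) • (genX Γ P κ i : BMWAlgebra Γ P κ) - 1) := by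
  rw [genE, ← map_smul, RingQuot.mkAlgHom_rel ℂ (Rel.quadratic i)]
  change proj Γ P κ _ = P.l κ i • (proj Γ P κ (gX i) * proj Γ P κ (gX i) +
    ((P.q κ i)⁻¹ - P.q κ i) • proj Γ P κ (gX i) - 1)
  rw [← map_mul, ← map_smul, ← map_add, ← map_one (proj Γ P κ), ← map_sub, ← map_smul]
  congr 2
  rw [sub_mul, mul_add, mul_add, smul_mul_assoc, one_mul, smul_mul_smul_comm,
    mul_inv_cancel₀ (q_ne_zero i), mul_smul_comm, mul_one, one_smul, one_mul, sub_smul]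
  abel

lemma genX_mul_genX (i : Fin n) :
    (genX Γ P κ i * genX Γ P κ i : BMWAlgebra Γ P κ) =
      1 + (P.q κ i - (P.q κ i)⁻¹) • (genX Γ P κ i : BMWAlgebra Γ P κ) +
        ((P.l κ i)⁻¹ * ((P.q κ i)⁻¹ - P.q κ i)) • genE Γ P κ i :=
  mul_self_eq_of_smul_eq (l_ne_zero i) (smul_genE i)

lemma genE_eq {i : Fin n} (hq : (P.q κ i)⁻¹ - P.q κ i ≠ 0) :
    genE Γ P κ i =
      (((P.q κ i)⁻¹ - P.q κ i)⁻¹ * P.l κ i) • (genX Γ P κ i * genX Γ P κ i : BMWAlgebra Γ P κ) +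
        P.l κ i • (genX Γ P κ i : BMWAlgebra Γ P κ) +
        (-(((P.q κ i)⁻¹ - P.q κ i)⁻¹ * P.l κ i)) • (1 : BMWAlgebra Γ P κ) :=
  eq_of_smul_eq hq (smul_genE i)

lemma genX_inv (i : Fin n) :
    (↑(genX Γ P κ i)⁻¹ : BMWAlgebra Γ P κ) =
      genX Γ P κ i + ((P.q κ i)⁻¹ - P.q κ i) • (1 : BMWAlgebra Γ P κ) +
        (P.q κ i - (P.q κ i)⁻¹) • genE Γ P κ i :=
  inv_eq_of_smul_eq (l_ne_zero i) (smul_genE i) (genX_mul_genE i)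

/-- An element that intertwines `X_i` and `X_j` intertwines `E_i` and `E_j`, provided that the
parameters agree. -/
lemma genE_mul_eq_mul_genE {i j : Fin n} (hq : (P.q κ i)⁻¹ - P.q κ i ≠ 0) (hk : P.k i = P.k j)
    (hα : P.α i = P.α j) {u : BMWAlgebra Γ P κ}
    (h : (genX Γ P κ i : BMWAlgebra Γ P κ) * u = u * genX Γ P κ j) :
    genE Γ P κ i * u = u * genE Γ P κ j := by
  have hqq : P.q κ i = P.q κ j := by rw [Parameters.q, Parameters.q, hk]
  have hll : P.l κ i = P.l κ j := by rw [Parameters.l, Parameters.l, hk, hα]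
  rw [genE_eq hq, genE_eq (hqq ▸ hq), hqq, hll]
  simp only [add_mul, mul_add, smul_mul_assoc, mul_smul_comm, one_mul, mul_one]
  rw [mul_assoc, h, ← mul_assoc, h, mul_assoc]

lemma genX_mem_genPair (i : Fin n) : (genX Γ P κ i : BMWAlgebra Γ P κ) ∈ genPair Γ P κ i :=
  Submodule.subset_span (by simp)

lemma genE_mem_genPair (i : Fin n) : genE Γ P κ i ∈ genPair Γ P κ i :=
  Submodule.subset_span (by simp)

lemma genPair_le_genSpan (i : Fin n) : genPair Γ P κ i ≤ genSpan Γ P κ :=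
  (le_iSup _ i).trans le_sup_right

lemma one_le_genSpan : 1 ≤ genSpan Γ P κ := le_sup_left

lemma genSpan_pow_mono {k l : ℕ} (h : k ≤ l) : genSpan Γ P κ ^ k ≤ genSpan Γ P κ ^ l :=
  pow_le_pow_right' one_le_genSpan h

lemma genPair_mul_self_le {i : Fin n} (hq : (P.q κ i)⁻¹ - P.q κ i ≠ 0) :
    genPair Γ P κ i * genPair Γ P κ i ≤ genSpan Γ P κ := by
  have hX := genPair_le_genSpan i (genX_mem_genPair (Γ := Γ) (P := P) (κ := κ) i)
  have hE := genPair_le_genSpan i (genE_mem_genPair (Γ := Γ) (P := P) (κ := κ) i)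
  rw [genPair, Submodule.span_mul_span, Submodule.span_le]
  rintro _ ⟨_, rfl | rfl, _, rfl | rfl, rfl⟩
  · dsimp only
    rw [SetLike.mem_coe, genX_mul_genX]
    exact add_mem (add_mem (one_le_genSpan (Submodule.one_le.1 le_rfl)) (Submodule.smul_mem _ _ hX))
      (Submodule.smul_mem _ _ hE)
  · dsimp only
    rw [SetLike.mem_coe, genX_mul_genE]
    exact Submodule.smul_mem _ _ hE
  · dsimp only
    rw [SetLike.mem_coe, genE_mul_genX]
    exact Submodule.smul_mem _ _ hE
  · dsimp only
    rw [SetLike.mem_coe]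
    nth_rw 2 [genE_eq hq]
    simp only [mul_add, mul_smul_comm, ← mul_assoc, genE_mul_genX, smul_mul_assoc, mul_one]
    exact add_mem (add_mem (Submodule.smul_mem _ _ (Submodule.smul_mem _ _ (Submodule.smul_mem _ _
      hE))) (Submodule.smul_mem _ _ (Submodule.smul_mem _ _ hE))) (Submodule.smul_mem _ _ hE)

/-! ### The relations of a pair of generators -/

lemma map_altProd {A B : Type} [Monoid A] [Monoid B] (f : A →* B) (a b : A) (k : ℕ) :
    f (altProd a b k) = altProd (f a) (f b) k := by
  induction k generalizing a b with
  | zero => exact map_one f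
  | succ k ih => rw [altProd, altProd, map_mul, ih]

lemma altProd_eq_alt {A : Type} [Monoid A] (x : ZMod 2 → A) (a : ZMod 2) (k : ℕ) :
    altProd (x a) (x (a + 1)) k = alt x a k := by
  induction k generalizing a with
  | zero => rfl
  | succ k ih =>
    rw [altProd, alt, ← ih (a + 1), show a + 1 + 1 = a by linear_combination zmod_two_two]

lemma prod_map_altWord {ι A : Type*} [Monoid A] (p : ι → A) (f : ZMod 2 → ι) (a : ZMod 2) (k : ℕ) :
    ((altWord (f a) (f (a + 1)) k).map p).prod = alt (fun a ↦ p (f a)) a k := by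
  induction k generalizing a with
  | zero => rfl
  | succ k ih =>
    rw [altWord, alt, ← ih (a + 1), show a + 1 + 1 = a by linear_combination zmod_two_two,
      List.map_cons, List.prod_cons]

lemma proj_braid {i j : Fin n} (hij : i ≠ j) :
    altProd (genX Γ P κ i) (genX Γ P κ j) (Γ i j) =
      altProd (genX Γ P κ j) (genX Γ P κ i) (Γ i j) := by
  apply Units.ext
  have h := RingQuot.mkAlgHom_rel ℂ (Rel.braid (Γ := Γ) (P := P) (κ := κ) i j hij)
  change (proj Γ P κ : FreeAlgebra ℂ (Gen n) →* BMWAlgebra Γ P κ) _ =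
    (proj Γ P κ : FreeAlgebra ℂ (Gen n) →* BMWAlgebra Γ P κ) _ at h
  rw [map_altProd, map_altProd] at h
  change Units.coeHom _ _ = Units.coeHom _ _
  rw [map_altProd, map_altProd]
  exact h

lemma mem_span_wordPair (i j : Fin n) {s : Set (BMWAlgebra Γ P κ)}
    (hs : s ⊆ {(genX Γ P κ i : BMWAlgebra Γ P κ), (genX Γ P κ j : BMWAlgebra Γ P κ),
      genE Γ P κ i, genE Γ P κ j}) {b : BMWAlgebra Γ P κ} (hb : b ∈ Algebra.adjoin ℂ s) :
    b ∈ Submodule.span ℂ (Set.range fun w ↦ proj Γ P κ (wordPair i j w)) := by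
  let f : FreeMonoid (Letter (Fin 2)) →* BMWAlgebra Γ P κ :=
    (proj Γ P κ : FreeAlgebra ℂ (Gen n) →* BMWAlgebra Γ P κ).comp
      (wordGen.comp (FreeMonoid.map (Letter.subst i j)))
  have hf (y : Letter (Fin 2)) : f (FreeMonoid.of y) = proj Γ P κ (letterGen (y.subst i j)) := rfl
  rw [← Subalgebra.mem_toSubmodule, Algebra.adjoin_eq_span] at hb
  refine Submodule.span_mono ?_ hb
  suffices Submonoid.closure s ≤ MonoidHom.mrange f from this
  rw [Submonoid.closure_le]
  refine hs.trans ?_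
  rintro _ (rfl | rfl | rfl | rfl)
  exacts [⟨_, hf (.X 0)⟩, ⟨_, hf (.X 1)⟩, ⟨_, hf (.E 0)⟩, ⟨_, hf (.E 1)⟩]

lemma exists_sandwich {y b : BMWAlgebra Γ P κ} {s : Set (BMWAlgebra Γ P κ)}
    (hb : b ∈ Submodule.span ℂ s) (h : ∀ w ∈ s, ∃ c : ℂ, y * w * y = c • y) :
    ∃ c : ℂ, y * b * y = c • y := by
  induction hb using Submodule.span_induction with
  | mem w hw => exact h w hw
  | zero => exact ⟨0, by simp⟩
  | add b₁ b₂ _ _ h₁ h₂ =>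
    obtain ⟨c₁, h₁⟩ := h₁
    obtain ⟨c₂, h₂⟩ := h₂
    exact ⟨c₁ + c₂, by rw [mul_add, add_mul, h₁, h₂, add_smul]⟩
  | smul r b _ h =>
    obtain ⟨c, h⟩ := h
    exact ⟨r * c, by rw [mul_smul_comm, smul_mul_assoc, h, mul_smul]⟩

lemma genE_mul_mul_genE_eq_zero {i j : Fin n} (hij : i ≠ j) (heven : Even (Γ i j)) (hgt : 2 < Γ i j)
    {b : BMWAlgebra Γ P κ}
    (hb : b ∈ Submodule.span ℂ (Set.range fun w ↦ proj Γ P κ (wordPair i j w))) :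
    genE Γ P κ i * b * genE Γ P κ j = 0 := by
  induction hb using Submodule.span_induction with
  | mem w hw =>
    obtain ⟨w, rfl⟩ := hw
    rw [genE, genE, ← map_mul, ← map_mul, RingQuot.mkAlgHom_rel ℂ (Rel.mixed i j hij heven hgt w),
      map_zero]
  | zero => simp
  | add b₁ b₂ _ _ h₁ h₂ => rw [mul_add, add_mul, h₁, h₂, add_zero]
  | smul r b _ h => rw [mul_smul_comm, smul_mul_assoc, h, smul_zero]

/-- The index `i` or `j`, according to the class in `ℤ/2`. -/
def pairIndex (i j : Fin n) (a : ZMod 2) : Fin n := if a = 0 then i else j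

lemma dihedralRelations (hq : ∀ i, (P.q κ i)⁻¹ - P.q κ i ≠ 0) {i j : Fin n} (hij : i < j)
    (hm : 3 ≤ Γ i j) :
    DihedralRelations ℂ (fun a ↦ genX Γ P κ (pairIndex i j a))
      (fun a ↦ genE Γ P κ (pairIndex i j a)) (Γ i j) := by
  have : NeZero (Γ i j) := ⟨by omega⟩
  have hs {s t : Fin n} (h : (s = i ∧ t = j) ∨ (s = j ∧ t = i)) :
      Set.range (fun a ↦ (genX Γ P κ (pairIndex i j a) : BMWAlgebra Γ P κ)) ∪
        Set.range (fun a ↦ genE Γ P κ (pairIndex i j a)) ⊆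
      {(genX Γ P κ s : BMWAlgebra Γ P κ), (genX Γ P κ t : BMWAlgebra Γ P κ),
        genE Γ P κ s, genE Γ P κ t} := by
    rintro _ (⟨a, rfl⟩ | ⟨a, rfl⟩) <;>
    · rcases h with ⟨rfl, rfl⟩ | ⟨rfl, rfl⟩ <;>
      · by_cases ha : a = 0 <;> simp [pairIndex, ha]
  have hbraid : alt (fun a ↦ genX Γ P κ (pairIndex i j a)) 0 (Γ i j) =
      alt (fun a ↦ genX Γ P κ (pairIndex i j a)) 1 (Γ i j) := by
    rw [← altProd_eq_alt, ← altProd_eq_alt]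
    exact proj_braid hij.ne
  have hparam (a : ZMod 2) : P.k (pairIndex i j a) = P.k (pairIndex i j (a + Γ i j)) ∧
      P.α (pairIndex i j a) = P.α (pairIndex i j (a + Γ i j)) := by
    rcases Nat.even_or_odd (Γ i j) with heven | hodd
    · rw [(ZMod.natCast_eq_zero_iff_even).2 heven, add_zero]
      exact ⟨rfl, rfl⟩
    · have hconj := Γ.toCoxeterSystem.isConj_simple_of_odd hodd
      rw [CoxeterMatrix.toCoxeterSystem_simple] at hconj
      have hk := P.k_conj i j hconj
      have hα := P.α_conj i j hconj
      rw [(ZMod.natCast_eq_one_iff_odd).2 hodd]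
      rcases zmod_two_eq_or a 0 with rfl | rfl
      · exact ⟨hk, hα⟩
      · exact ⟨hk.symm, hα.symm⟩
  refine ⟨hm, fun a ↦ ⟨_, _, genX_inv _⟩, fun a ↦ ⟨_, _, genX_mul_genX _⟩,
    fun a ↦ ⟨_, _, _, genE_eq (hq _)⟩, fun a ↦ ⟨_, genX_mul_genE _⟩, fun a ↦ ⟨_, genE_mul_genX _⟩,
    hbraid, fun a ↦ ?_, fun a b hb ↦ ?_, fun heven a b hb ↦ ?_⟩
  · refine genE_mul_eq_mul_genE (hq _) (hparam a).1 (hparam a).2 ?_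
    rw [← Units.val_mul, ← Units.val_mul, Units.val_inj]
    have hm1 : Γ i j - 1 + 1 = Γ i j := by omega
    have h1 := alt_succ (fun a ↦ genX Γ P κ (pairIndex i j a)) a (Γ i j - 1)
    have h2 := alt_succ' (fun a ↦ genX Γ P κ (pairIndex i j a)) (a + 1) (Γ i j - 1)
    rw [hm1] at h1 h2
    have h3 : a + 1 + (Γ i j - 1 : ℕ) = a + (Γ i j : ℕ) := by
      conv_rhs => rw [← hm1]
      push_cast
      ring
    rw [h3] at h2
    rw [← h1, ← h2]
    rcases zmod_two_eq_or a 0 with rfl | rfl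
    · exact hbraid
    · exact hbraid.symm
  · refine exists_sandwich (mem_span_wordPair i j (hs (Or.inl ⟨rfl, rfl⟩)) hb) ?_
    rintro _ ⟨w, rfl⟩
    rcases zmod_two_eq_or a 0 with rfl | rfl
    · refine ⟨_, (?_ : genE Γ P κ i * _ * genE Γ P κ i = P.Phi κ i j 0 w • genE Γ P κ i)⟩
      rw [genE, ← map_mul, ← map_mul, ← map_smul,
        RingQuot.mkAlgHom_rel ℂ (Rel.sandwich_left i j hij w)]
    · refine ⟨_, (?_ : genE Γ P κ j * _ * genE Γ P κ j = P.Phi κ i j 1 w • genE Γ P κ j)⟩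
      rw [genE, ← map_mul, ← map_mul, ← map_smul,
        RingQuot.mkAlgHom_rel ℂ (Rel.sandwich_right i j hij w)]
  · rcases zmod_two_eq_or a 0 with rfl | rfl
    · exact genE_mul_mul_genE_eq_zero hij.ne heven hm
        (mem_span_wordPair i j (hs (Or.inl ⟨rfl, rfl⟩)) hb)
    · have hsymm : Γ j i = Γ i j := Γ.symmetric j i
      exact genE_mul_mul_genE_eq_zero hij.ne' (hsymm ▸ heven) (hsymm ▸ hm)
        (mem_span_wordPair j i (hs (Or.inr ⟨rfl, rfl⟩)) hb)

/-! ### Rewriting words -/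

lemma wordSpan_append (ω ω' : List (Fin n)) :
    wordSpan Γ P κ (ω ++ ω') = wordSpan Γ P κ ω * wordSpan Γ P κ ω' := by
  rw [wordSpan, List.map_append, List.prod_append]
  rfl

lemma wordSpan_cons (i : Fin n) (ω : List (Fin n)) :
    wordSpan Γ P κ (i :: ω) = genPair Γ P κ i * wordSpan Γ P κ ω := by
  rw [wordSpan, List.map_cons, List.prod_cons]
  rfl

lemma wordSpan_le (ω : List (Fin n)) : wordSpan Γ P κ ω ≤ genSpan Γ P κ ^ ω.length := by
  induction ω with
  | nil => exact le_rfl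
  | cons i ω ih =>
    rw [wordSpan_cons, List.length_cons, pow_succ']
    exact mul_le_mul' (genPair_le_genSpan i) ih

lemma wordSpan_altWord_le (hq : ∀ i, (P.q κ i)⁻¹ - P.q κ i ≠ 0) {i j : Fin n} (hij : i ≠ j)
    (hM : Γ i j ≠ 0) :
    wordSpan Γ P κ (altWord i j (Γ i j)) ≤
      genSpan Γ P κ ^ (Γ i j - 1) ⊔ wordSpan Γ P κ (altWord j i (Γ i j)) := by
  have h1 : Γ i j ≠ 1 := Γ.off_diagonal i j hij
  rcases eq_or_ne (Γ i j) 2 with h2 | h2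
  · -- here all letters with the index `i` commute with all letters with the index `j`
    have hb := proj_braid (P := P) (κ := κ) hij
    rw [h2] at hb ⊢
    have hX : Commute (genX Γ P κ i : BMWAlgebra Γ P κ) (genX Γ P κ j) := by
      simpa [altProd, Units.ext_iff, commute_iff_eq] using hb
    have hE {k : Fin n} {y : BMWAlgebra Γ P κ} (h : Commute (genX Γ P κ k : BMWAlgebra Γ P κ) y) :
        Commute (genE Γ P κ k) y := genE_mul_eq_mul_genE (hq k) rfl rfl h
    refine le_sup_of_le_right ?_
    simp only [wordSpan, altWord, List.map_cons, List.map_nil, List.prod_cons, List.prod_nil,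
      mul_one]
    rw [genPair, genPair, Submodule.span_mul_span, Submodule.span_mul_span]
    refine Submodule.span_mono ?_
    rintro _ ⟨y, hy, z, hz, rfl⟩
    refine ⟨z, hz, y, hy, ?_⟩
    have hXz : Commute (genX Γ P κ i : BMWAlgebra Γ P κ) z := by
      rcases hz with rfl | rfl
      exacts [hX, (hE hX.symm).symm]
    rcases hy with rfl | rfl
    exacts [hXz.symm, (hE hXz).symm]
  · have key {i j : Fin n} (hij : i < j) (hm : 3 ≤ Γ i j) (a : ZMod 2) :
        wordSpan Γ P κ (altWord (pairIndex i j a) (pairIndex i j (a + 1)) (Γ i j)) ≤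
          genSpan Γ P κ ^ (Γ i j - 1) ⊔ wordSpan Γ P κ
            (altWord (pairIndex i j (a + 1)) (pairIndex i j (a + 1 + 1)) (Γ i j)) := by
      rw [wordSpan, wordSpan, prod_map_altWord, prod_map_altWord]
      refine ((dihedralRelations hq hij hm).alt_pair_le_alt_pair a (a + 1)).trans ?_
      refine sup_le_sup_right (pow_le_pow_left' ?_ _) _
      exact sup_le le_sup_left (sup_le (genPair_le_genSpan _) (genPair_le_genSpan _))
    rcases lt_or_gt_of_ne hij with hlt | hlt
    · exact key hlt (by omega) 0
    · have hsymm : Γ j i = Γ i j := Γ.symmetric j i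
      have := key hlt (by omega) 1
      rw [hsymm] at this
      exact this

lemma wordSpan_le_of_braidMove (hq : ∀ i, (P.q κ i)⁻¹ - P.q κ i ≠ 0) {ω ω' : List (Fin n)}
    (h : Γ.BraidMove ω ω') :
    wordSpan Γ P κ ω ≤ genSpan Γ P κ ^ (ω.length - 1) ⊔ wordSpan Γ P κ ω' ∧
      ω'.length = ω.length := by
  obtain ⟨a, b, i, j, hij, hM⟩ := h
  refine ⟨?_, by simp⟩
  rw [wordSpan_append, wordSpan_append, wordSpan_append, wordSpan_append]
  refine (mul_le_mul' (mul_le_mul' le_rfl (wordSpan_altWord_le hq hij hM)) le_rfl).trans ?_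
  rw [Submodule.mul_sup, Submodule.sup_mul]
  refine sup_le_sup_right ?_ _
  refine (mul_le_mul' (mul_le_mul' (wordSpan_le a) le_rfl) (wordSpan_le b)).trans ?_
  rw [← pow_add, ← pow_add]
  refine genSpan_pow_mono ?_
  have : 0 < Γ i j := Nat.pos_of_ne_zero hM
  simp
  omega

lemma wordSpan_le_of_reflTransGen (hq : ∀ i, (P.q κ i)⁻¹ - P.q κ i ≠ 0) {ω ω' : List (Fin n)}
    (h : ReflTransGen Γ.BraidMove ω ω') :
    wordSpan Γ P κ ω ≤ genSpan Γ P κ ^ (ω.length - 1) ⊔ wordSpan Γ P κ ω' ∧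
      ω'.length = ω.length := by
  induction h with
  | refl => exact ⟨le_sup_right, rfl⟩
  | tail _ hm ih =>
    obtain ⟨h1, h2⟩ := wordSpan_le_of_braidMove hq hm
    rw [ih.2] at h1 h2
    exact ⟨ih.1.trans (sup_le le_sup_left h1), h2⟩

/-- A word whose indices form a non-reduced word of the Coxeter group is a combination of shorter
words. -/
lemma wordSpan_le_of_not_isReduced (hq : ∀ i, (P.q κ i)⁻¹ - P.q κ i ≠ 0) {ω : List (Fin n)}
    (hω : ¬ Γ.toCoxeterSystem.IsReduced ω) :
    wordSpan Γ P κ ω ≤ genSpan Γ P κ ^ (ω.length - 1) := by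
  obtain ⟨a, i, b, h⟩ := CoxeterSystem.exists_reflTransGen_braidMove_of_not_isReduced hω
  obtain ⟨h1, h2⟩ := wordSpan_le_of_reflTransGen hq h
  refine h1.trans (sup_le le_rfl ?_)
  rw [wordSpan_append, wordSpan_cons, wordSpan_cons, ← mul_assoc (genPair Γ P κ i), ← h2]
  refine (mul_le_mul' (wordSpan_le a) (mul_le_mul' (genPair_mul_self_le (hq i))
    (wordSpan_le b))).trans ?_
  rw [← pow_succ', ← pow_add]
  refine genSpan_pow_mono ?_
  simp

lemma genSpan_pow_le_iSup (k : ℕ) :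
    genSpan Γ P κ ^ k ≤ ⨆ ω : {ω : List (Fin n) // ω.length ≤ k}, wordSpan Γ P κ ω := by
  induction k with
  | zero => exact le_iSup_of_le ⟨[], le_rfl⟩ le_rfl
  | succ k ih =>
    rw [pow_succ']
    refine (mul_le_mul' le_rfl ih).trans ?_
    rw [Submodule.mul_iSup]
    refine iSup_le fun ⟨ω, hω⟩ ↦ ?_
    rw [genSpan, Submodule.sup_mul, one_mul, Submodule.iSup_mul]
    refine sup_le (le_iSup_of_le ⟨ω, hω.trans k.le_succ⟩ le_rfl) (iSup_le fun i ↦ ?_)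
    exact le_iSup_of_le ⟨i :: ω, Nat.succ_le_succ hω⟩ (wordSpan_cons i ω).ge

lemma genSpan_pow_succ_le (hq : ∀ i, (P.q κ i)⁻¹ - P.q κ i ≠ 0) {N : ℕ}
    (hN : ∀ w : Γ.Group, Γ.toCoxeterSystem.length w ≤ N) :
    genSpan Γ P κ ^ (N + 1) ≤ genSpan Γ P κ ^ N := by
  refine (genSpan_pow_le_iSup (N + 1)).trans (iSup_le fun ⟨ω, hω⟩ ↦ ?_)
  change wordSpan Γ P κ ω ≤ _
  rcases Nat.lt_or_ge N ω.length with h | h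
  · refine (wordSpan_le_of_not_isReduced hq fun hr ↦ ?_).trans (genSpan_pow_mono (by omega))
    have := hr.eq.symm.trans_le (hN _)
    omega
  · exact (wordSpan_le ω).trans (genSpan_pow_mono h)

lemma genSpan_pow_eq_top {N : ℕ} (h : genSpan Γ P κ ^ (N + 1) ≤ genSpan Γ P κ ^ N) :
    genSpan Γ P κ ^ N = ⊤ := by
  have hmul {y z : BMWAlgebra Γ P κ} (hy : y ∈ genSpan Γ P κ) (hz : z ∈ genSpan Γ P κ ^ N) :
      y * z ∈ genSpan Γ P κ ^ N := h (by rw [pow_succ']; exact Submodule.mul_mem_mul hy hz)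
  have key (b : FreeAlgebra ℂ (Gen n)) :
      ∀ z ∈ genSpan Γ P κ ^ N, proj Γ P κ b * z ∈ genSpan Γ P κ ^ N := by
    induction b using FreeAlgebra.induction with
    | grade0 r =>
      intro z hz
      rw [AlgHom.commutes, ← Algebra.smul_def]
      exact Submodule.smul_mem _ _ hz
    | grade1 g =>
      intro z hz
      refine hmul ?_ hz
      have hX (i : Fin n) := genPair_le_genSpan i (genX_mem_genPair (Γ := Γ) (P := P) (κ := κ) i)
      have hE (i : Fin n) := genPair_le_genSpan i (genE_mem_genPair (Γ := Γ) (P := P) (κ := κ) i)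
      match g with
      | .X i => exact hX i
      | .E i => exact hE i
      | .Xinv i =>
        change (↑(genX Γ P κ i)⁻¹ : BMWAlgebra Γ P κ) ∈ _
        rw [genX_inv]
        exact add_mem (add_mem (hX i) (Submodule.smul_mem _ _ (one_le_genSpan
          (Submodule.one_le.1 le_rfl)))) (Submodule.smul_mem _ _ (hE i))
    | mul b c hb hc =>
      intro z hz
      rw [map_mul, mul_assoc]
      exact hb _ (hc z hz)
    | add b c hb hc =>
      intro z hz
      rw [map_add, add_mul]
      exact add_mem (hb z hz) (hc z hz)
  rw [eq_top_iff]
  intro b _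
  obtain ⟨b, rfl⟩ := RingQuot.mkAlgHom_surjective ℂ (Rel Γ P κ) b
  have := key b 1 (Submodule.one_le.1 (one_le_pow_of_one_le' one_le_genSpan N))
  rwa [mul_one] at this

lemma genSpan_pow_le_span_wordElem (k : ℕ) :
    genSpan Γ P κ ^ k ≤ Submodule.span ℂ
      {x | ∃ w : FreeMonoid (Letter (Fin n)), w.length ≤ k ∧ x = wordElem Γ P κ w} := by
  induction k with
  | zero =>
    rw [pow_zero, Submodule.one_le]
    exact Submodule.subset_span ⟨1, le_rfl, by rw [wordElem, map_one, map_one]⟩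
  | succ k ih =>
    have hmul (y : Letter (Fin n)) (w : FreeMonoid (Letter (Fin n))) :
        proj Γ P κ (letterGen y) * wordElem Γ P κ w = wordElem Γ P κ (FreeMonoid.of y * w) := by
      rw [wordElem, wordElem, map_mul, map_mul, wordGen, FreeMonoid.lift_eval_of]
    rw [pow_succ']
    refine (mul_le_mul' le_rfl ih).trans ?_
    rw [genSpan, Submodule.sup_mul, one_mul, Submodule.iSup_mul]
    refine sup_le (Submodule.span_mono ?_) (iSup_le fun i ↦ ?_)
    · rintro _ ⟨w, hw, rfl⟩
      exact ⟨w, hw.trans k.le_succ, rfl⟩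
    · rw [genPair, Submodule.span_mul_span]
      refine Submodule.span_mono ?_
      rintro _ ⟨_, rfl | rfl, _, ⟨w, hw, rfl⟩, rfl⟩
      · exact ⟨FreeMonoid.of (Letter.X i) * w, by simp; omega, hmul (.X i) w⟩
      · exact ⟨FreeMonoid.of (Letter.E i) * w, by simp; omega, hmul (.E i) w⟩

lemma genSpan_fg : (genSpan Γ P κ).FG := by
  refine Submodule.FG.sup ?_ (Submodule.fg_iSup _ fun i ↦ ?_)
  · rw [Submodule.one_eq_span]
    exact Submodule.fg_span_singleton 1
  · exact Submodule.fg_span (Set.toFinite _)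

end Generators

end BMW

theorem theorem5p1 {n : ℕ} (Γ : CoxeterMatrix (Fin n)) (hΓ : Finite Γ.Group)
    (P : BMW.Parameters Γ) (κ : ℂ) (hq : ∀ i, (P.q κ i)⁻¹ - P.q κ i ≠ 0) :
    FiniteDimensional ℂ (BMW.BMWAlgebra Γ P κ) ∧
      ∃ w₀ : Γ.Group,
        (∀ w : Γ.Group, Γ.toCoxeterSystem.length w ≤ Γ.toCoxeterSystem.length w₀) ∧
        Submodule.span ℂ
          {x : BMW.BMWAlgebra Γ P κ | ∃ w : FreeMonoid (BMW.Letter (Fin n)),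
            w.length ≤ Γ.toCoxeterSystem.length w₀ ∧ x = BMW.wordElem Γ P κ w} = ⊤ := by
  obtain ⟨w₀, hw₀⟩ := Finite.exists_max Γ.toCoxeterSystem.length
  have htop := BMW.genSpan_pow_eq_top (BMW.genSpan_pow_succ_le hq hw₀)
  refine ⟨⟨?_⟩, w₀, hw₀, ?_⟩
  · rw [← htop]
    exact BMW.genSpan_fg.pow _
  · rw [eq_top_iff, ← htop]
    exact BMW.genSpan_pow_le_span_wordElem _
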